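/- Let $G$ be a finite simple graph with $n(G)$ vertices and $m(G)$ edges. For $S\subseteq V(G)$, a Steiner $S$-tree of $G$ is a connected subgraph of $G$ that contains $S$ and has the minimum number of edges among all such subgraphs. For $v\in V(G)$, the Steiner $k$-eccentricity $\mathrm{ecc}_k(v,G)$ is the maximum of the sizes (numbers of edges) of the Steiner $S$-trees of $G$ over all sets $S\subseteq V(G)$ with $|S|=k$ and $v\in S$. A block of $G$ is a maximal connected subgraph without a cut vertex, and $G$ is a block graph if each of its blocks is a clique. For a connected block graph $G$ and $v\in V(G)$, let $T(v,G)$ be the graph obtained from $G$ by removing, for every block $B$ of $G$, all edges of $B$ that are not incident with the vertex of $B$ nearest to $v$. **Theorem.** Let $G$ be a connected block graph, $v\in V(G)$, and let $k$ be an integer with $3\le k\le n(G)$. Then the algorithm 1. determine $T(v,G)$; 2. return $\mathrm{ecc}_k(v,T(v,G))$ computes $\mathrm{ecc}_k(v,G)$; that is, $\mathrm{ecc}_k(v,T(v,G))=\mathrm{ecc}_k(v,G)$. Moreover, the algorithm can be implemented, on a random access machine with unit cost per instruction and with graphs given by adjacency lists, to run in $O(k(n(G)+m(G)))$ time, with an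 absolute implied constant. -/

import Mathlib

/-! ### Steiner eccentricity -/

namespace SteinerEcc

variable {V : Type*}

/-- `H` is a connected subgraph of `G` that contains all vertices of `S`. -/
def Spans (G : SimpleGraph V) (S : Set V) (H : G.Subgraph) : Prop :=
  H.Connected ∧ S ⊆ H.verts

/-- `T` is a Steiner `S`-tree of `G`: a connected subgraph containing `S` with the minimum
number of edges. -/
def IsSteinerTree (G : SimpleGraph V) (S : Set V) (T : G.Subgraph) : Prop :=
  Spans G S T ∧ ∀ T' : G.Subgraph, Spans G S T' → T.edgeSet.ncard ≤ T'.edgeSet.ncard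

/-- The sizes of the Steiner `S`-trees of `G`, over all `k`-sets `S` of vertices with `v ∈ S`. -/
def steinerSizes (G : SimpleGraph V) (k : ℕ) (v : V) : Set ℕ :=
  {m | ∃ (S : Finset V) (T : G.Subgraph),
    S.card = k ∧ v ∈ S ∧ IsSteinerTree G (S : Set V) T ∧ T.edgeSet.ncard = m}

/-- `e` is the Steiner `k`-eccentricity of `v` in `G`, i.e. the maximum of `steinerSizes G k v`
(in particular that maximum exists). -/
def IsEcc (G : SimpleGraph V) (k : ℕ) (v : V) (e : ℕ) : Prop :=
  IsGreatest (steinerSizes G k v) e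

/-! ### Blocks, block graphs and the tree `T(v,G)` -/

/-- A connected subgraph without a cut vertex: deleting any one of its vertices leaves no two
vertices in different components. -/
def IsNonseparable {G : SimpleGraph V} (H : G.Subgraph) : Prop :=
  H.Connected ∧ ∀ x ∈ H.verts, (H.deleteVerts {x}).coe.Preconnected

/-- A block of `G`: a maximal connected subgraph without a cut vertex. -/
def IsBlock {G : SimpleGraph V} (B : G.Subgraph) : Prop :=
  Maximal IsNonseparable B

/-- A block graph: every block is a clique. -/
def IsBlockGraph (G : SimpleGraph V) : Prop :=
  ∀ B : G.Subgraph, IsBlock B → G.IsClique B.verts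

/-- `x` is a vertex of `B` nearest to `v`. -/
def IsNearest (G : SimpleGraph V) (v : V) (B : G.Subgraph) (x : V) : Prop :=
  x ∈ B.verts ∧ ∀ y ∈ B.verts, G.dist v x ≤ G.dist v y

/-- The graph `T(v,G)`: for every block `B`, remove from `G` every edge of `B` that is not
incident with the vertex of `B` nearest to `v`. -/
def nearTree (v : V) (G : SimpleGraph V) : SimpleGraph V :=
  G.deleteEdges {e | ∃ B : G.Subgraph, IsBlock B ∧ e ∈ B.edgeSet ∧ ∀ x ∈ e, ¬ IsNearest G v B x}

end SteinerEcc

/-! ### A random access machine with unit cost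

A program uses finitely many registers and finitely many arrays, all holding natural numbers.
The only arithmetic is `+ 1` and `- 1`, so that after `t` steps no number exceeds the largest
number in the input or the program by more than `t`. -/

namespace RAM

/-- The memory: registers `reg x` and array cells `arr a i`. -/
structure State where
  reg : ℕ → ℕ
  arr : ℕ → ℕ → ℕ

/-- Assign `c` to register `x`. -/
def State.setReg (s : State) (x c : ℕ) : State :=
  { s with reg := Function.update s.reg x c }

/-- Assign `c` to cell `i` of array `a`. -/
def State.setArr (s : State) (a i c : ℕ) : State :=
  { s with arr := Function.update s.arr a (Function.update (s.arr a) i c) }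

/-- Comparisons of two registers. -/
inductive Test where
  | eq (x y : ℕ)
  | lt (x y : ℕ)

def Test.Holds (s : State) : Test → Prop
  | .eq x y => s.reg x = s.reg y
  | .lt x y => s.reg x < s.reg y

inductive Prog where
  | skip
  /-- `x := c` for a constant `c` of the program -/
  | const (x c : ℕ)
  /-- `x := y` -/
  | copy (x y : ℕ)
  /-- `x := x + 1` -/
  | inc (x : ℕ)
  /-- `x := x - 1` (truncated at `0`) -/
  | dec (x : ℕ)
  /-- `x := a[y]` -/
  | load (x a y : ℕ)
  /-- `a[x] := y` -/
  | store (a x y : ℕ)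
  | seq (p q : Prog)
  | cond (c : Test) (p q : Prog)
  | loop (c : Test) (p : Prog)

/-- `Exec p s t s'`: started in memory `s`, the program `p` halts after exactly `t` steps in
memory `s'`. Each basic instruction and each evaluation of a test is one step. -/
inductive Exec : Prog → State → ℕ → State → Prop where
  | skip (s : State) : Exec .skip s 1 s
  | const (s : State) (x c : ℕ) : Exec (.const x c) s 1 (s.setReg x c)
  | copy (s : State) (x y : ℕ) : Exec (.copy x y) s 1 (s.setReg x (s.reg y))
  | inc (s : State) (x : ℕ) : Exec (.inc x) s 1 (s.setReg x (s.reg x + 1))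
  | dec (s : State) (x : ℕ) : Exec (.dec x) s 1 (s.setReg x (s.reg x - 1))
  | load (s : State) (x a y : ℕ) : Exec (.load x a y) s 1 (s.setReg x (s.arr a (s.reg y)))
  | store (s : State) (a x y : ℕ) : Exec (.store a x y) s 1 (s.setArr a (s.reg x) (s.reg y))
  | seq {p q : Prog} {s s₁ s₂ : State} {t₁ t₂ : ℕ} :
      Exec p s t₁ s₁ → Exec q s₁ t₂ s₂ → Exec (.seq p q) s (t₁ + t₂) s₂
  | condTrue {c : Test} {p q : Prog} {s s' : State} {t : ℕ} :
      c.Holds s → Exec p s t s' → Exec (.cond c p q) s (t + 1) s'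
  | condFalse {c : Test} {p q : Prog} {s s' : State} {t : ℕ} :
      ¬ c.Holds s → Exec q s t s' → Exec (.cond c p q) s (t + 1) s'
  | loopTrue {c : Test} {p : Prog} {s s₁ s₂ : State} {t₁ t₂ : ℕ} :
      c.Holds s → Exec p s t₁ s₁ → Exec (.loop c p) s₁ t₂ s₂ →
      Exec (.loop c p) s (t₁ + t₂ + 1) s₂
  | loopFalse {c : Test} {p : Prog} {s : State} :
      ¬ c.Holds s → Exec (.loop c p) s 1 s

/-- The memory `s` holds the instance `(v, G, k)`: registers `0`, `1`, `2` hold the order `n`, the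
vertex `v` and the number `k`; the graph is stored by adjacency lists in arrays `0` and `1`: the
cells of array `1` from position `arr 0 u` (inclusive) to position `arr 0 (u + 1)` (exclusive)
list the neighbours of `u`, each once, in any order. All other memory is arbitrary. -/
structure Holds {n : ℕ} (s : State) (v : Fin n) (G : SimpleGraph (Fin n)) (k : ℕ) : Prop where
  order : s.reg 0 = n
  vertex : s.reg 1 = v
  param : s.reg 2 = k
  start : s.arr 0 0 = 0
  mono : ∀ u : Fin n, s.arr 0 u ≤ s.arr 0 ((u : ℕ) + 1)
  lists : ∀ u : Fin n, Set.BijOn (s.arr 1) (Set.Ico (s.arr 0 u) (s.arr 0 ((u : ℕ) + 1)))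
    (Fin.val '' G.neighborSet u)

end RAM

/-! ### Combinatorics: block graphs, Steiner trees through the root, and heights. -/

namespace SteinerEcc

variable {V : Type*} {G : SimpleGraph V}

/-! ### Blocks -/

/-! In a connected block graph every vertex other than `v` has exactly one neighbour nearer to `v`,
its parent, and adjacent vertices at equal distance from `v` have the same parent. The edges of
`T(v,G)` are exactly those between parent and child, so `G` and `T(v,G)` share one parent map `p`
(`exists_isParentMap`, `IsParentMap.of_adj_iff`).

An edge of either graph leads to the parent, to a child or to a sibling. Hence a connected subgraph
containing `v` contains all iterated parents of its vertices, and a Steiner tree of a set containing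
`v` has one edge fewer than the set has ancestors (`IsParentMap.steinerSizes_eq`). This number
depends on `p` alone, which gives the equality of the eccentricities.

For the running time the maximum is made explicit: it is the sum over all heights of the smaller of
`k - 1` and the number of non-root vertices of that height (`IsParentMap.isEcc`). Distinct vertices
of equal height are not ancestors of each other, so `k - 1` vertices account for at most `k - 1` of
each height; choosing vertices greedily from the greatest height downwards attains all these bounds
at once. The machine finds `p` by a search from `v`, prunes the lists, computes heights backwards
along the queue and counts with truncation, in linear time throughout. -/

theorem reachable_coe_of_reflTransGen {H : G.Subgraph} {a b : V} (ha : a ∈ H.verts)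
    (h : Relation.ReflTransGen H.Adj a b) :
    ∃ hb : b ∈ H.verts, H.coe.Reachable ⟨a, ha⟩ ⟨b, hb⟩ := by
  induction h with
  | refl => exact ⟨ha, .rfl⟩
  | tail _ hbc ih =>
    obtain ⟨hb, hr⟩ := ih
    exact ⟨hbc.snd_mem, hr.trans (SimpleGraph.Adj.reachable (by simpa using hbc))⟩

theorem preconnected_coe_of_reflTransGen {H : G.Subgraph} (a : V) (ha : a ∈ H.verts)
    (h : ∀ b ∈ H.verts, Relation.ReflTransGen H.Adj a b) : H.coe.Preconnected := by
  rintro ⟨b, hb⟩ ⟨c, hc⟩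
  obtain ⟨_, h₁⟩ := reachable_coe_of_reflTransGen ha (h b hb)
  obtain ⟨_, h₂⟩ := reachable_coe_of_reflTransGen ha (h c hc)
  exact h₁.symm.trans h₂

theorem reflTransGen_of_chain {r : V → V → Prop} {f : ℕ → V} {a b : ℕ} (hab : a ≤ b)
    (h : ∀ i, a ≤ i → i < b → r (f i) (f (i + 1))) : Relation.ReflTransGen r (f a) (f b) := by
  induction b, hab using Nat.le_induction with
  | base => exact .refl
  | succ b hab ih =>
    exact (ih fun i h₁ h₂ => h i h₁ (by omega)).tail (h b hab (by omega))

/-- A vertex together with a path that joins two of its neighbours and avoids it induces a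
nonseparable subgraph. -/
theorem isNonseparable_induce_insert {c : V} {f : ℕ → V} {m : ℕ}
    (hadj : ∀ i < m, G.Adj (f i) (f (i + 1))) (hinj : Set.InjOn f (Set.Iic m))
    (h0 : G.Adj c (f 0)) (hm : G.Adj c (f m)) (hc : ∀ i ≤ m, f i ≠ c) :
    IsNonseparable ((⊤ : G.Subgraph).induce (insert c (f '' Set.Iic m))) := by
  set S := insert c (f '' Set.Iic m) with hS
  have hcS : c ∈ S := Set.mem_insert _ _
  have hfS : ∀ i ≤ m, f i ∈ S := fun i hi => Set.mem_insert_of_mem _ ⟨i, hi, rfl⟩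
  refine ⟨⟨{ preconnected := ?_, nonempty := ⟨⟨c, hcS⟩⟩ }⟩, ?_⟩
  · refine preconnected_coe_of_reflTransGen c hcS ?_
    rintro b (rfl | ⟨i, hi, rfl⟩)
    · exact .refl
    · refine .head (b := f 0) (by simp [hcS, hfS 0, h0]) ?_
      refine reflTransGen_of_chain (Nat.zero_le _) fun j _ hj => ?_
      have : i ≤ m := hi
      simp [hfS j (by omega), hfS (j + 1) (by omega), hadj j (by omega)]
  · rintro x (rfl | ⟨j, hj, rfl⟩)
    · refine preconnected_coe_of_reflTransGen (f 0) (by simp [hfS 0, hc 0]) ?_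
      rintro b ⟨rfl | ⟨i, hi, rfl⟩, hbx⟩
      · simp at hbx
      · refine reflTransGen_of_chain (Nat.zero_le _) fun j _ hj => ?_
        have : i ≤ m := hi
        simp [hfS j (by omega), hfS (j + 1) (by omega), hadj j (by omega), hc j (by omega),
          hc (j + 1) (by omega)]
    · have hj' : j ≤ m := hj
      have hne : ∀ i ≤ m, i ≠ j → f i ≠ f j := fun i hi hij h => hij (hinj hi hj h)
      have hcj : c ≠ f j := (hc j hj').symm
      refine preconnected_coe_of_reflTransGen c (by simp [hcS, hcj]) ?_
      rintro b ⟨rfl | ⟨i, hi, rfl⟩, hbx⟩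
      · exact .refl
      · have hi' : i ≤ m := hi
        have hij : i ≠ j := by rintro rfl; simp at hbx
        rcases lt_or_gt_of_ne hij with hlt | hgt
        · refine .head (b := f 0)
            (by simp [hcS, hfS 0, h0, hcj, hne 0 (by omega) (by omega)]) ?_
          refine reflTransGen_of_chain (Nat.zero_le _) fun l _ hl => ?_
          simp [hfS l (by omega), hfS (l + 1) (by omega), hadj l (by omega),
            hne l (by omega) (by omega), hne (l + 1) (by omega) (by omega)]
        · refine .head (b := f m)
            (by simp [hcS, hfS m, hm, hcj, hne m le_rfl (by omega)]) ?_
          have := reflTransGen_of_chain (a := 0) (b := m - i) (f := fun l => f (m - l))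
            (r := (((⊤ : G.Subgraph).induce S).deleteVerts {f j}).Adj) (Nat.zero_le _) ?_
          · simpa [Nat.sub_sub_self hi'] using this
          · intro l _ hl
            have hl' : m - l = (m - (l + 1)) + 1 := by omega
            have := (hadj (m - (l + 1)) (by omega)).symm
            rw [← hl'] at this
            simp [hfS (m - l) (by omega), hfS (m - (l + 1)) (by omega), this,
              hne (m - l) (by omega) (by omega), hne (m - (l + 1)) (by omega) (by omega)]

/-- Two neighbours of `c` that are joined by a walk avoiding `c` lie in a common block with `c`. -/
theorem exists_isBlock_of_walk [Finite V] {c y z : V} (hy : G.Adj c y) (hz : G.Adj c z)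
    (q : G.Walk y z) (hq : c ∉ q.support) :
    ∃ B : G.Subgraph, IsBlock B ∧ B.Adj c y ∧ B.Adj c z := by
  classical
  -- The walk is shortened to a path; with `c` it closes up to a cycle, which by finiteness lies in
  -- a maximal nonseparable subgraph.
  have hq' : c ∉ q.bypass.support := fun h => hq (q.support_bypass_subset_support h)
  have hH := isNonseparable_induce_insert (G := G) (c := c) (f := q.bypass.getVert)
    (m := q.bypass.length) (fun i hi => q.bypass.adj_getVert_succ hi)
    (q.bypass_isPath.getVert_injOn) (by simpa using hy) (by simpa using hz)
    (fun i _ h => hq' (h ▸ q.bypass.getVert_mem_support i))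
  obtain ⟨B, hHB, hB⟩ := Finite.exists_le_maximal hH
  refine ⟨B, hB, hHB.2 ?_, hHB.2 ?_⟩
  · have : y ∈ q.bypass.getVert '' Set.Iic q.bypass.length := ⟨0, by simp⟩
    simp [hy, this]
  · have : z ∈ q.bypass.getVert '' Set.Iic q.bypass.length := ⟨q.bypass.length, by simp⟩
    simp [hz, this]

theorem IsBlockGraph.adj_of_walk [Finite V] (hG : IsBlockGraph G) {c y z : V} (hy : G.Adj c y)
    (hz : G.Adj c z) (hyz : y ≠ z) (q : G.Walk y z) (hq : c ∉ q.support) : G.Adj y z := by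
  obtain ⟨B, hB, h₁, h₂⟩ := exists_isBlock_of_walk hy hz q hq
  exact hG B hB h₁.snd_mem h₂.snd_mem hyz

/-! ### Parent maps -/

/-- `p` sends every vertex but the root `v` to a neighbour, its iterates end at the root, and
adjacent vertices are parent and child or have the same image. -/
structure IsParentMap (G : SimpleGraph V) (v : V) (p : V → V) : Prop where
  root : p v = v
  adj : ∀ u, u ≠ v → G.Adj u (p u)
  reach : ∀ u, ∃ i, p^[i] u = v
  edge : ∀ u w, G.Adj u w → p u = w ∨ p w = u ∨ p u = p w

theorem exists_adj_dist_add_one (hG : G.Connected) {v u : V} (h : u ≠ v) :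
    ∃ w, G.Adj u w ∧ G.dist v w + 1 = G.dist v u := by
  obtain ⟨q, hq⟩ := hG.exists_walk_length_eq_dist u v
  cases q with
  | nil => exact absurd rfl h
  | cons hadj q =>
    rename_i w
    refine ⟨w, hadj, ?_⟩
    have h₁ := SimpleGraph.dist_le q
    have h₂ := hG.dist_triangle (u := v) (v := w) (w := u)
    rw [SimpleGraph.dist_eq_one_iff_adj.2 hadj.symm] at h₂
    rw [SimpleGraph.dist_comm] at hq h₁
    simp only [SimpleGraph.Walk.length_cons] at hq
    omega

/-- A shortest walk. It misses every vertex other than `u` that is at least as far from `v` as `u`,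
which is how walks avoiding a given vertex are found. -/
theorem exists_walk_descending (hG : G.Connected) (v u : V) :
    ∃ q : G.Walk u v, ∀ x ∈ q.support, x = u ∨ G.dist v x < G.dist v u := by
  induction hd : G.dist v u generalizing u with
  | zero =>
    obtain rfl : v = u := hG.dist_eq_zero_iff.1 hd
    exact ⟨.nil, by simp⟩
  | succ d ih =>
    have hu : u ≠ v := by rintro rfl; simp at hd
    obtain ⟨w, hw, hd'⟩ := exists_adj_dist_add_one hG hu
    obtain ⟨q, hq⟩ := ih w (by omega)
    refine ⟨.cons hw q, fun x hx => ?_⟩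
    rw [SimpleGraph.Walk.support_cons, List.mem_cons] at hx
    rcases hx with rfl | hx
    · exact .inl rfl
    · rcases hq x hx with rfl | h <;> right <;> omega

/-- Two descending walks, from `y` and from `z`, are joined at `v`; neither meets `c`. -/
theorem exists_walk_avoiding (hG : G.Connected) {v c y z : V} (hcy : c ≠ y) (hcz : c ≠ z)
    (hy : G.dist v y ≤ G.dist v c) (hz : G.dist v z ≤ G.dist v c) :
    ∃ q : G.Walk y z, c ∉ q.support := by
  obtain ⟨q₁, h₁⟩ := exists_walk_descending hG v y
  obtain ⟨q₂, h₂⟩ := exists_walk_descending hG v z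
  refine ⟨q₁.append q₂.reverse, fun h => ?_⟩
  rw [SimpleGraph.Walk.mem_support_append_iff, SimpleGraph.Walk.support_reverse,
    List.mem_reverse] at h
  rcases h with h | h
  · rcases h₁ c h with h | h
    · exact hcy h
    · omega
  · rcases h₂ c h with h | h
    · exact hcz h
    · omega

theorem dist_le_add_one_of_adj (hG : G.Connected) {v a b : V} (h : G.Adj a b) :
    G.dist v b ≤ G.dist v a + 1 := by
  have := hG.dist_triangle (u := v) (v := a) (w := b)
  rwa [SimpleGraph.dist_eq_one_iff_adj.2 h] at this

theorem ne_of_dist_lt {v a b : V} (h : G.dist v a < G.dist v b) : a ≠ b := by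
  rintro rfl; exact lt_irrefl _ h

/-- In a block graph, a vertex nearer to `v` than its neighbour `b` is also adjacent to the
neighbours of `b` at the same distance as `b`. -/
theorem IsBlockGraph.adj_of_dist_eq [Finite V] (hG : G.Connected) (hB : IsBlockGraph G)
    {v a b x : V} (hab : G.Adj a b) (hd : G.dist v a = G.dist v b) (hx : G.Adj a x)
    (hxd : G.dist v x + 1 = G.dist v a) : G.Adj x b := by
  obtain ⟨q, hq⟩ := exists_walk_avoiding hG (v := v) hx.ne hab.ne (by omega) hd.ge
  exact hB.adj_of_walk hx hab (ne_of_dist_lt (v := v) (G := G) (by omega)) q hq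

/-- Otherwise `a` and `b` are adjacent, being joined by a walk that avoids `c`. A nearer neighbour
`x` of `a` is then adjacent to `b`, and the walk `c`, `a`, `x` avoids `b`, so `c` is adjacent to
`x`. But `x` is nearer to `v` than `c` by two. -/
theorem IsBlockGraph.nearer_neighbor_unique [Finite V] (hG : G.Connected) (hB : IsBlockGraph G)
    {v a b c : V} (ha : G.Adj c a) (hb : G.Adj c b) (had : G.dist v a + 1 = G.dist v c)
    (hbd : G.dist v b + 1 = G.dist v c) : a = b := by
  by_contra hab
  obtain ⟨q, hq⟩ := exists_walk_avoiding hG (v := v) ha.ne hb.ne (by omega) (by omega)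
  have hadj := hB.adj_of_walk ha hb hab q hq
  have hav : a ≠ v := by
    rintro rfl
    rw [SimpleGraph.dist_self] at had
    exact hab (hG.dist_eq_zero_iff.1 (by omega))
  obtain ⟨x, hx, hxd⟩ := exists_adj_dist_add_one hG hav
  have hxb := hB.adj_of_dist_eq hG hadj (by omega) hx hxd
  have hcx : G.Adj c x := by
    refine hB.adj_of_walk hb.symm hxb.symm
      (ne_of_dist_lt (v := v) (G := G) (by omega)).symm (.cons ha (.cons hx .nil)) ?_
    simp [hb.ne', hadj.ne', hxb.ne']
  have := dist_le_add_one_of_adj hG (v := v) hcx.symm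
  omega

theorem exists_isParentMap [Finite V] (hG : G.Connected) (hB : IsBlockGraph G) (v : V) :
    ∃ p : V → V, IsParentMap G v p ∧
      ∀ u w, (nearTree v G).Adj u w ↔ u ≠ w ∧ (p u = w ∨ p w = u) := by
  classical
  have hex : ∀ u, ∃ w, (u = v → w = v) ∧ (u ≠ v → G.Adj u w ∧ G.dist v w + 1 = G.dist v u) := by
    intro u
    by_cases h : u = v
    · exact ⟨v, by simp [h]⟩
    · obtain ⟨w, hw⟩ := exists_adj_dist_add_one hG h
      exact ⟨w, by simp [h, hw]⟩
  choose p hpv hp using hex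
  have hne : ∀ {a b}, G.dist v a < G.dist v b → b ≠ v := by
    rintro a b h rfl; simp at h
  have hpar : ∀ {a b}, G.Adj a b → G.dist v a < G.dist v b → p b = a := by
    intro a b hab hlt
    have hb := hp b (hne hlt)
    have := dist_le_add_one_of_adj hG (v := v) hab
    exact hB.nearer_neighbor_unique hG hb.1 hab.symm hb.2 (by omega)
  have hsib : ∀ {a b}, G.Adj a b → G.dist v a = G.dist v b →
      a ≠ v ∧ G.Adj (p a) b ∧ p a = p b := by
    intro a b hab hd
    have hav : a ≠ v := by
      rintro rfl
      rw [SimpleGraph.dist_self] at hd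
      exact hab.ne (hG.dist_eq_zero_iff.1 hd.symm)
    have ha := hp a hav
    have h := hB.adj_of_dist_eq hG hab hd ha.1 ha.2
    exact ⟨hav, h, (hpar h (by omega)).symm⟩
  refine ⟨p, ⟨hpv v rfl, fun u hu => (hp u hu).1, ?_, ?_⟩, ?_⟩
  · intro u
    induction hd : G.dist v u generalizing u with
    | zero => exact ⟨0, (hG.dist_eq_zero_iff.1 hd).symm⟩
    | succ d ih =>
      have hu : u ≠ v := by rintro rfl; simp at hd
      obtain ⟨i, hi⟩ := ih (p u) (by have := (hp u hu).2; omega)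
      exact ⟨i + 1, hi⟩
  · intro u w huw
    rcases lt_trichotomy (G.dist v u) (G.dist v w) with h | h | h
    · exact .inr (.inl (hpar huw h))
    · exact .inr (.inr (hsib huw h).2.2)
    · exact .inl (hpar huw.symm h)
  -- Such an edge survives: in a block containing it all other vertices are adjacent to `b`, hence
  -- none is nearer to `v` than `a`.
  · have hkey : ∀ a b, G.Adj a b → G.dist v a < G.dist v b → (nearTree v G).Adj a b := by
      intro a b hab hlt
      rw [nearTree, SimpleGraph.deleteEdges_adj]
      refine ⟨hab, ?_⟩
      rintro ⟨B, hBl, he, hn⟩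
      rw [SimpleGraph.Subgraph.mem_edgeSet] at he
      refine hn a (by simp) ⟨he.fst_mem, fun y hy => ?_⟩
      by_cases hyb : y = b
      · rw [hyb]; exact hlt.le
      · have h₁ := dist_le_add_one_of_adj hG (v := v) (hB B hBl hy he.snd_mem hyb)
        omega
    intro u w
    constructor
    · intro h
      refine ⟨h.ne, ?_⟩
      rw [nearTree, SimpleGraph.deleteEdges_adj] at h
      obtain ⟨huw, hrem⟩ := h
      rcases lt_trichotomy (G.dist v u) (G.dist v w) with hlt | heq | hgt
      · exact .inr (hpar huw hlt)
      -- An edge between siblings is removed: some block contains both ends and their parent, which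
      -- is nearer to `v`.
      · refine absurd ?_ hrem
        obtain ⟨huv, hpw, -⟩ := hsib huw heq
        have hu := hp u huv
        obtain ⟨B, hBl, h₁, h₂⟩ := exists_isBlock_of_walk hu.1 huw (.cons hpw .nil)
          (by simp [hu.1.ne, huw.ne])
        refine ⟨B, hBl, by simpa using h₂, fun x hx hn => ?_⟩
        have := hn.2 _ h₁.snd_mem
        rcases Sym2.mem_iff.1 hx with rfl | rfl <;> omega
      · exact .inl (hpar huw.symm hgt)
    · rintro ⟨huw, rfl | rfl⟩
      · have hu : u ≠ v := by rintro rfl; exact huw (hpv u rfl).symm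
        exact (hkey _ _ (hp u hu).1.symm (by have := (hp u hu).2; omega)).symm
      · have hw : w ≠ v := by rintro rfl; exact huw (hpv w rfl)
        exact hkey _ _ (hp w hw).1.symm (by have := (hp w hw).2; omega)

theorem IsParentMap.ne {v : V} {p : V → V} (hp : IsParentMap G v p) {u : V} (hu : u ≠ v) :
    u ≠ p u := (hp.adj u hu).ne

/-- The tree of a parent map has the same parent map. -/
theorem IsParentMap.of_adj_iff {v : V} {p : V → V} (hp : IsParentMap G v p) {T : SimpleGraph V}
    (hT : ∀ u w, T.Adj u w ↔ u ≠ w ∧ (p u = w ∨ p w = u)) : IsParentMap T v p where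
  root := hp.root
  adj u hu := (hT _ _).2 ⟨hp.ne hu, .inl rfl⟩
  reach := hp.reach
  edge u w h := by
    rcases ((hT u w).1 h).2 with h | h
    · exact .inl h
    · exact .inr (.inl h)

end SteinerEcc

namespace SteinerEcc

variable {V : Type*} {G : SimpleGraph V}

/-! ### Steiner trees containing the root of a parent map -/

/-- The vertices of `S` and all their iterated parents. -/
def ancestors (p : V → V) (S : Set V) : Set V :=
  {x | ∃ s ∈ S, ∃ i, p^[i] s = x}

theorem subset_ancestors (p : V → V) (S : Set V) : S ⊆ ancestors p S :=
  fun s hs => ⟨s, hs, 0, rfl⟩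

theorem ancestors_mono (p : V → V) {S S' : Set V} (h : S ⊆ S') :
    ancestors p S ⊆ ancestors p S' :=
  fun _ ⟨s, hs, hi⟩ => ⟨s, h hs, hi⟩

theorem map_mem_ancestors {p : V → V} {S : Set V} {x : V} (hx : x ∈ ancestors p S) :
    p x ∈ ancestors p S := by
  obtain ⟨s, hs, i, rfl⟩ := hx
  exact ⟨s, hs, i + 1, Function.iterate_succ_apply' p i s⟩

variable {v : V} {p : V → V}

/-- A connected subgraph that contains the root contains the iterated parents of its vertices. -/
theorem IsParentMap.ancestors_subset_verts (hp : IsParentMap G v p) {S : Set V} (hv : v ∈ S)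
    {H : G.Subgraph} (hH : Spans G S H) : ancestors p S ⊆ H.verts := by
  rintro x ⟨s, hs, i, hi⟩
  by_contra hx
  -- Along a walk in `H`, the vertex `x` stays an iterated parent of the current vertex. As `x` is
  -- outside `H`, at least one iteration is needed, so a step to a parent, child or sibling changes
  -- the count by `-1`, `1` or `0`. At the root this forces `x = v`.
  have key : ∀ a : H.verts, H.coe.Reachable ⟨s, hH.2 hs⟩ a → ∃ j, p^[j] a.1 = x := by
    intro a ha
    rw [SimpleGraph.reachable_iff_reflTransGen] at ha
    induction ha with
    | refl => exact ⟨i, hi⟩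
    | @tail b c _ hbc ih =>
      obtain ⟨j, hj⟩ := ih
      obtain _ | j := j
      · exact absurd (hj ▸ b.2) hx
      · rw [Function.iterate_succ_apply] at hj
        rcases hp.edge _ _ (H.adj_sub hbc) with h | h | h
        · exact ⟨j, h ▸ hj⟩
        · exact ⟨j + 2, by rwa [Function.iterate_succ_apply, h, Function.iterate_succ_apply]⟩
        · exact ⟨j + 1, by rwa [Function.iterate_succ_apply, ← h]⟩
  obtain ⟨j, hj⟩ := key ⟨v, hH.2 hv⟩ (hH.1.coe.preconnected _ _)
  rw [Function.iterate_fixed hp.root] at hj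
  exact hx (hj ▸ hH.2 hv)

theorem ncard_verts_le [Finite V] {H : G.Subgraph} (hH : H.Connected) :
    H.verts.ncard ≤ H.edgeSet.ncard + 1 := by
  have h := hH.coe.card_vert_le_card_edgeSet_add_one
  rw [Nat.card_coe_set_eq, Nat.card_coe_set_eq] at h
  rwa [← SimpleGraph.Subgraph.image_coe_edgeSet_coe,
    Set.ncard_image_of_injective _ (Sym2.map.injective Subtype.val_injective)]

/-- The subgraph formed by the edges from the vertices in `ancestors p S` to their parents. -/
def IsParentMap.ancestorTree (hp : IsParentMap G v p) (S : Set V) : G.Subgraph where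
  verts := ancestors p S
  -- The condition `a ≠ b` discards the loop that `p v = v` would give.
  Adj a b := a ≠ b ∧ (a ∈ ancestors p S ∧ p a = b ∨ b ∈ ancestors p S ∧ p b = a)
  adj_sub := by
    rintro a b ⟨hab, ⟨-, rfl⟩ | ⟨-, rfl⟩⟩
    · exact hp.adj a (by rintro rfl; exact hab hp.root.symm)
    · exact (hp.adj b (by rintro rfl; exact hab hp.root)).symm
  edge_vert := by
    rintro a b ⟨-, ⟨h, -⟩ | ⟨h, rfl⟩⟩
    · exact h
    · exact map_mem_ancestors h
  symm := ⟨fun a b ⟨h, h'⟩ => ⟨h.symm, h'.symm⟩⟩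

theorem IsParentMap.spans_ancestorTree (hp : IsParentMap G v p) {S : Set V} (hv : v ∈ S) :
    Spans G S (hp.ancestorTree S) := by
  refine ⟨⟨{ preconnected := ?_, nonempty := ⟨⟨v, subset_ancestors p S hv⟩⟩ }⟩,
    subset_ancestors p S⟩
  refine preconnected_coe_of_reflTransGen v (subset_ancestors p S hv) fun b hb => ?_
  obtain ⟨i, hi⟩ := hp.reach b
  induction i generalizing b with
  | zero => rw [show b = v from hi]
  | succ i ih =>
    rw [Function.iterate_succ_apply] at hi
    by_cases hbv : b = v
    · rw [hbv]
    · exact (ih (p b) (map_mem_ancestors hb) hi).tail ⟨(hp.ne hbv).symm, .inr ⟨hb, rfl⟩⟩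

theorem IsParentMap.ncard_edgeSet_ancestorTree_le [Finite V] (hp : IsParentMap G v p) (S : Set V)
    (hv : v ∈ S) : (hp.ancestorTree S).edgeSet.ncard ≤ (ancestors p S).ncard - 1 := by
  rw [← Set.ncard_sdiff_singleton_of_mem (subset_ancestors p S hv)]
  refine le_trans (Set.ncard_le_ncard (t := (fun x => s(x, p x)) '' (ancestors p S \ {v})) ?_)
    (Set.ncard_image_le)
  intro e
  induction e with | _ a b
  intro he
  obtain ⟨hab, ⟨h, hb⟩ | ⟨h, ha⟩⟩ := SimpleGraph.Subgraph.mem_edgeSet.1 he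
  · exact ⟨a, ⟨h, by rintro rfl; exact hab (hp.root.symm.trans hb)⟩, by simp [hb]⟩
  · exact ⟨b, ⟨h, by rintro rfl; exact hab (ha.symm.trans hp.root)⟩, by simp [ha, Sym2.eq_swap]⟩

theorem IsParentMap.isSteinerTree_ncard [Finite V] (hp : IsParentMap G v p) {S : Set V}
    (hv : v ∈ S) {T : G.Subgraph} (hT : IsSteinerTree G S T) :
    T.edgeSet.ncard = (ancestors p S).ncard - 1 := by
  refine le_antisymm ((hT.2 _ (hp.spans_ancestorTree hv)).trans
    (hp.ncard_edgeSet_ancestorTree_le S hv)) ?_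
  have h₁ := Set.ncard_le_ncard (hp.ancestors_subset_verts hv hT.1)
  have h₂ := ncard_verts_le hT.1.1
  omega

theorem IsParentMap.isSteinerTree_ancestorTree [Finite V] (hp : IsParentMap G v p) {S : Set V}
    (hv : v ∈ S) : IsSteinerTree G S (hp.ancestorTree S) := by
  refine ⟨hp.spans_ancestorTree hv, fun T hT => (hp.ncard_edgeSet_ancestorTree_le S hv).trans ?_⟩
  have h₁ := Set.ncard_le_ncard (hp.ancestors_subset_verts hv hT)
  have h₂ := ncard_verts_le hT.1
  omega

/-- The ancestors lie in every competitor, and a connected graph has at least as many edges as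
vertices minus one; `ancestorTree` attains this. The right-hand side does not involve the edges of
`G`. -/
theorem IsParentMap.steinerSizes_eq [Finite V] (hp : IsParentMap G v p) (k : ℕ) :
    steinerSizes G k v =
      {m | ∃ S : Finset V, S.card = k ∧ v ∈ S ∧ (ancestors p (S : Set V)).ncard - 1 = m} := by
  ext m
  constructor
  · rintro ⟨S, T, hS, hv, hT, rfl⟩
    exact ⟨S, hS, hv, (hp.isSteinerTree_ncard hv hT).symm⟩
  · rintro ⟨S, hS, hv, rfl⟩
    exact ⟨S, _, hS, hv, hp.isSteinerTree_ancestorTree hv,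
      hp.isSteinerTree_ncard hv (hp.isSteinerTree_ancestorTree hv)⟩

/-! ### The eccentricity in terms of heights -/

/-- `h` is the height of the vertices in the rooted tree given by `p`: it increases towards the
root, and every vertex of positive height has a child one lower. -/
structure IsHeight (v : V) (p : V → V) (h : V → ℕ) : Prop where
  lt : ∀ u, u ≠ v → h u < h (p u)
  child : ∀ u i, h u = i + 1 → ∃ w, w ≠ v ∧ p w = u ∧ h w = i

/-- The non-root vertices of height `i`. -/
def heightLevel [Fintype V] [DecidableEq V] (v : V) (h : V → ℕ) (i : ℕ) : Finset V :=
  {u | u ≠ v ∧ h u = i}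

theorem IsHeight.add_le_iterate {h : V → ℕ} (hh : IsHeight v p h) (hv : p v = v) {u : V} {m : ℕ}
    (hm : p^[m] u ≠ v) : h u + m ≤ h (p^[m] u) := by
  induction m generalizing u with
  | zero => simp
  | succ m ih =>
    rw [Function.iterate_succ_apply] at hm ⊢
    have hu : u ≠ v := by
      rintro rfl
      rw [hv, Function.iterate_fixed hv] at hm
      exact hm rfl
    have := hh.lt u hu
    have := ih hm
    omega

variable [Fintype V] [DecidableEq V] {h : V → ℕ}

open Classical in
-- Each ancestor is sent to a member of `S` below it. Two non-root vertices on one chain of parents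
-- differ in height, so the map is injective; the root is not a value, being its own only ancestor.
theorem IsHeight.card_ancestors_level_le (hh : IsHeight v p h) (hv : p v = v) (S : Finset V)
    (i : ℕ) :
    ((heightLevel v h i).filter (· ∈ ancestors p (S : Set V))).card ≤ (S.erase v).card := by
  have hex : ∀ u ∈ (heightLevel v h i).filter (· ∈ ancestors p (S : Set V)),
      ∃ s ∈ S, ∃ j, p^[j] s = u := fun u hu => (Finset.mem_filter.1 hu).2
  choose! f hf g hg using hex
  have hne : ∀ u ∈ (heightLevel v h i).filter (· ∈ ancestors p (S : Set V)), u ≠ v ∧ h u = i :=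
    fun u hu => by simpa [heightLevel] using (Finset.mem_filter.1 hu).1
  have main : ∀ a ∈ (heightLevel v h i).filter (· ∈ ancestors p (S : Set V)),
      ∀ b ∈ (heightLevel v h i).filter (· ∈ ancestors p (S : Set V)),
      f a = f b → g a ≤ g b → a = b := by
    intro a ha b hb hab hle
    obtain ⟨m, hm⟩ := Nat.exists_eq_add_of_le' hle
    have h₁ := hg b hb
    rw [hm, Function.iterate_add_apply, ← hab, hg a ha] at h₁
    have h₂ := hh.add_le_iterate hv (h₁ ▸ (hne b hb).1)
    rw [h₁, (hne a ha).2, (hne b hb).2] at h₂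
    obtain rfl : m = 0 := by omega
    exact h₁
  refine Finset.card_le_card_of_injOn f (fun u hu => ?_) fun a ha b hb hab => ?_
  · refine Finset.mem_erase.2 ⟨fun h => ?_, hf u hu⟩
    have := hg u hu
    rw [h, Function.iterate_fixed hv] at this
    exact (hne u hu).1 this.symm
  · rcases le_total (g a) (g b) with hle | hle
    · exact main a ha b hb hab hle
    · exact (main b hb a ha hab.symm hle).symm

open Classical in
/-- Some `j` vertices have, in every height level, at least `min j` of the level as ancestors. -/
theorem IsHeight.exists_finset (hh : IsHeight v p h) {N : ℕ} (hN : ∀ u, h u < N) (j : ℕ) :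
    ∃ A : Finset V, v ∉ A ∧ A.card ≤ j ∧ ∀ l, min j (heightLevel v h l).card ≤
      ((heightLevel v h l).filter (· ∈ ancestors p (A : Set V))).card := by
  -- The levels are treated from the greatest height downwards, with `A` always inside the lowest
  -- level treated so far.
  suffices H : ∀ i ≤ N, ∃ A ⊆ heightLevel v h (N - i),
      A.card = min j (heightLevel v h (N - i)).card ∧
      ∀ l, N - i ≤ l → min j (heightLevel v h l).card ≤
        ((heightLevel v h l).filter (· ∈ ancestors p (A : Set V))).card by
    obtain ⟨A, hA, hcard, hl⟩ := H N le_rfl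
    refine ⟨A, fun hvA => ?_, by omega, fun l => hl l (by omega)⟩
    simpa [heightLevel] using hA hvA
  intro i hi
  induction i with
  | zero =>
    have hempty : ∀ l, N ≤ l → heightLevel v h l = ∅ := by
      intro l hl
      ext u
      have := hN u
      simp only [heightLevel, Finset.mem_filter, Finset.mem_univ, true_and, Finset.notMem_empty,
        iff_false, not_and]
      omega
    refine ⟨∅, by simp, by simp [hempty N le_rfl], fun l hl => by simp [hempty l hl]⟩
  | succ i ih =>
    obtain ⟨A, hA, hcard, hl⟩ := ih (by omega)
    set x := N - (i + 1) with hx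
    have hx' : N - i = x + 1 := by omega
    rw [hx'] at hA hcard hl
    have hex : ∀ u ∈ heightLevel v h (x + 1), ∃ w, w ≠ v ∧ p w = u ∧ h w = x := fun u hu =>
      hh.child u x (by simpa [heightLevel] using (Finset.mem_filter.1 hu).2.2)
    -- Each vertex of `A` is replaced by a child one lower, which keeps all ancestors already
    -- gained. Distinct vertices have distinct children, so levels do not shrink downwards and the
    -- new set can be filled up to the required size.
    choose! c hcv hcp hch using hex
    have hinj : Set.InjOn c (heightLevel v h (x + 1)) := fun a ha b hb hab => by
      rw [← hcp a ha, ← hcp b hb, hab]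
    have hmem : ∀ u ∈ heightLevel v h (x + 1), c u ∈ heightLevel v h x := fun u hu => by
      simp [heightLevel, hcv u hu, hch u hu]
    have hle : (heightLevel v h (x + 1)).card ≤ (heightLevel v h x).card :=
      Finset.card_le_card_of_injOn c hmem hinj
    have hcA : (A.image c).card = A.card := Finset.card_image_of_injOn (hinj.mono hA)
    obtain ⟨B, hAB, hB, hBcard⟩ := Finset.exists_subsuperset_card_eq
      (s := A.image c) (t := heightLevel v h x) (n := min j (heightLevel v h x).card)
      (fun w hw => by
        obtain ⟨u, hu, rfl⟩ := Finset.mem_image.1 hw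
        exact hmem u (hA hu))
      (by omega) (by omega)
    refine ⟨B, hB, hBcard, fun l hxl => ?_⟩
    rcases eq_or_lt_of_le hxl with rfl | hlt
    · rw [← hBcard]
      exact Finset.card_le_card fun w hw =>
        Finset.mem_filter.2 ⟨hB hw, subset_ancestors p _ hw⟩
    · refine (hl l (by omega)).trans (Finset.card_le_card ?_)
      refine Finset.monotone_filter_right _ fun w _ hw => ?_
      obtain ⟨s, hs, n, hn⟩ := hw
      refine ⟨c s, hAB (Finset.mem_image_of_mem c hs), n + 1, ?_⟩
      rw [Function.iterate_succ_apply, hcp s (hA hs), hn]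

open Classical in
theorem ncard_ancestors_sub_one {N : ℕ} (hN : ∀ u, h u < N) {S : Set V} (hv : v ∈ S) :
    (ancestors p S).ncard - 1 =
      ∑ l ∈ Finset.range N, ((heightLevel v h l).filter (· ∈ ancestors p S)).card := by
  rw [← Set.ncard_sdiff_singleton_of_mem (subset_ancestors p S hv)]
  rw [Set.ncard_eq_toFinset_card', Finset.card_eq_sum_card_fiberwise (f := h) (t := Finset.range N)
    (fun u _ => by simpa using hN u)]
  refine Finset.sum_congr rfl fun l _ => congrArg Finset.card ?_
  ext u
  simp only [heightLevel, Finset.mem_filter, Set.mem_toFinset, Set.mem_sdiff,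
    Set.mem_singleton_iff, Finset.mem_univ, true_and]
  tauto

/-- The Steiner `k`-eccentricity of the root counts, in every height level, at most `k - 1`
vertices. -/
theorem IsParentMap.isEcc (hp : IsParentMap G v p) (hh : IsHeight v p h) {N k : ℕ}
    (hN : ∀ u, h u < N) (hk : 1 ≤ k) (hkV : k ≤ Fintype.card V) :
    IsEcc G k v (∑ l ∈ Finset.range N, min (k - 1) (heightLevel v h l).card) := by
  classical
  rw [IsEcc, hp.steinerSizes_eq]
  have upper : ∀ S : Finset V, S.card = k → v ∈ S → (ancestors p (S : Set V)).ncard - 1 ≤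
      ∑ l ∈ Finset.range N, min (k - 1) (heightLevel v h l).card := by
    intro S hS hv
    rw [ncard_ancestors_sub_one hN (Finset.mem_coe.2 hv)]
    refine Finset.sum_le_sum fun l _ => le_min ?_ (Finset.card_filter_le _ _)
    have := hh.card_ancestors_level_le hp.root S l
    rwa [Finset.card_erase_of_mem hv, hS] at this
  refine ⟨?_, ?_⟩
  · obtain ⟨A, hvA, hcard, hl⟩ := hh.exists_finset hN (k - 1)
    -- Arbitrary further vertices bring the size to exactly `k`; they can only add ancestors.
    obtain ⟨S, hAS, -, hS⟩ := Finset.exists_subsuperset_card_eq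
      (Finset.subset_univ (insert v A)) (n := k)
      (by rw [Finset.card_insert_of_notMem hvA]; omega) (by simpa using hkV)
    have hv : v ∈ S := hAS (Finset.mem_insert_self v A)
    refine ⟨S, hS, hv, le_antisymm (upper S hS hv) ?_⟩
    rw [ncard_ancestors_sub_one hN (Finset.mem_coe.2 hv)]
    refine Finset.sum_le_sum fun l _ => (hl l).trans (Finset.card_le_card ?_)
    refine Finset.monotone_filter_right _ fun w _ hw => ancestors_mono p ?_ hw
    exact fun a ha => hAS (Finset.mem_insert_of_mem ha)
  · rintro m ⟨S, hS, hv, rfl⟩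
    exact upper S hS hv

end SteinerEcc

/-! ### Implementation on the machine and its running time. -/

namespace RAM

/-! ### Total correctness with running times -/

/-- A precondition for `p` to halt after `t` steps in a memory `s'` with `Q t s'`. -/
def WP : Prog → (ℕ → State → Prop) → State → Prop
  | .skip, Q, s => Q 1 s
  | .const x c, Q, s => Q 1 (s.setReg x c)
  | .copy x y, Q, s => Q 1 (s.setReg x (s.reg y))
  | .inc x, Q, s => Q 1 (s.setReg x (s.reg x + 1))
  | .dec x, Q, s => Q 1 (s.setReg x (s.reg x - 1))
  | .load x a y, Q, s => Q 1 (s.setReg x (s.arr a (s.reg y)))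
  | .store a x y, Q, s => Q 1 (s.setArr a (s.reg x) (s.reg y))
  | .seq p q, Q, s => WP p (fun t s' => WP q (fun t' s'' => Q (t + t') s'') s') s
  | .cond c p q, Q, s => (c.Holds s → WP p (fun t s' => Q (t + 1) s') s) ∧
      (¬ c.Holds s → WP q (fun t s' => Q (t + 1) s') s)
  | .loop c p, Q, s => ∃ t s', Exec (.loop c p) s t s' ∧ Q t s'

theorem WP.seq_iff {p q : Prog} {Q : ℕ → State → Prop} {s : State} :
    WP (.seq p q) Q s ↔ WP p (fun t s' => WP q (fun t' s'' => Q (t + t') s'') s') s := Iff.rfl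

theorem WP.const_iff {x c : ℕ} {Q : ℕ → State → Prop} {s : State} :
    WP (.const x c) Q s ↔ Q 1 (s.setReg x c) := Iff.rfl

theorem WP.copy_iff {x y : ℕ} {Q : ℕ → State → Prop} {s : State} :
    WP (.copy x y) Q s ↔ Q 1 (s.setReg x (s.reg y)) := Iff.rfl

theorem WP.dec_iff {x : ℕ} {Q : ℕ → State → Prop} {s : State} :
    WP (.dec x) Q s ↔ Q 1 (s.setReg x (s.reg x - 1)) := Iff.rfl

theorem WP.exists_exec {p : Prog} {Q : ℕ → State → Prop} {s : State} (h : WP p Q s) :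
    ∃ t s', Exec p s t s' ∧ Q t s' := by
  induction p generalizing Q s with
  | skip => exact ⟨_, _, .skip s, h⟩
  | const x c => exact ⟨_, _, .const s x c, h⟩
  | copy x y => exact ⟨_, _, .copy s x y, h⟩
  | inc x => exact ⟨_, _, .inc s x, h⟩
  | dec x => exact ⟨_, _, .dec s x, h⟩
  | load x a y => exact ⟨_, _, .load s x a y, h⟩
  | store a x y => exact ⟨_, _, .store s a x y, h⟩
  | seq p q ihp ihq =>
    obtain ⟨t₁, s₁, h₁, h₂⟩ := ihp h
    obtain ⟨t₂, s₂, h₃, h₄⟩ := ihq h₂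
    exact ⟨_, _, .seq h₁ h₃, h₄⟩
  | cond c p q ihp ihq =>
    by_cases hc : c.Holds s
    · obtain ⟨t, s', h₁, h₂⟩ := ihp (h.1 hc)
      exact ⟨_, _, .condTrue hc h₁, h₂⟩
    · obtain ⟨t, s', h₁, h₂⟩ := ihq (h.2 hc)
      exact ⟨_, _, .condFalse hc h₁, h₂⟩
  | loop c p _ => exact h

theorem WP.mono {p : Prog} {Q Q' : ℕ → State → Prop} {s : State} (h : WP p Q s)
    (hQ : ∀ t s', Q t s' → Q' t s') : WP p Q' s := by
  induction p generalizing Q Q' s with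
  | seq p q ihp ihq => exact ihp h fun t s' h' => ihq h' fun t' s'' => hQ _ _
  | cond c p q ihp ihq =>
    exact ⟨fun hc => ihp (h.1 hc) fun t s' => hQ _ _, fun hc => ihq (h.2 hc) fun t s' => hQ _ _⟩
  | loop c p _ =>
    obtain ⟨t, s', h₁, h₂⟩ := h
    exact ⟨t, s', h₁, hQ _ _ h₂⟩
  | _ => exact hQ _ _ h

theorem WP.seq {p q : Prog} {Q : ℕ → State → Prop} {s : State} {R : ℕ → State → Prop}
    (hp : WP p R s) (hq : ∀ t s', R t s' → WP q (fun t' s'' => Q (t + t') s'') s') :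
    WP (.seq p q) Q s :=
  WP.mono (p := p) hp hq

/-- The rule for loops: `I t s` is an invariant that relates the memory to the number `t` of steps
spent so far, and `μ` decreases in every iteration. -/
theorem WP.loop {c : Test} {p : Prog} (I : ℕ → State → Prop) (μ : State → ℕ)
    (hstep : ∀ t s, I t s → c.Holds s → WP p (fun t' s' => I (t + t' + 1) s' ∧ μ s' < μ s) s)
    {Q : ℕ → State → Prop} {s : State} (h0 : I 0 s)
    (hQ : ∀ t s', I t s' → ¬ c.Holds s' → Q (t + 1) s') : WP (.loop c p) Q s := by
  -- The separate `+ 1` is the final test, which fails and is not counted by the invariant.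
  suffices H : ∀ t s, I t s → ∃ t' s', Exec (.loop c p) s (t' + 1) s' ∧ I (t + t') s' ∧
      ¬ c.Holds s' by
    obtain ⟨t, s', h₁, h₂, h₃⟩ := H 0 s h0
    exact ⟨_, s', h₁, hQ _ _ (by simpa using h₂) h₃⟩
  intro t s
  induction hm : μ s using Nat.strong_induction_on generalizing t s with
  | _ m ih =>
    intro hI
    by_cases hc : c.Holds s
    · obtain ⟨t₁, s₁, h₁, h₂, h₃⟩ := (hstep t s hI hc).exists_exec
      obtain ⟨t₂, s₂, h₄, h₅, h₆⟩ := ih (μ s₁) (hm ▸ h₃) (t + t₁ + 1) s₁ rfl h₂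
      refine ⟨t₁ + t₂ + 1, s₂, .loopTrue (t₂ := t₂ + 1) hc h₁ h₄, ?_, h₆⟩
      rwa [show t + (t₁ + t₂ + 1) = t + t₁ + 1 + t₂ by omega]
    · exact ⟨0, s, .loopFalse hc, hI, hc⟩

end RAM

namespace RAM

open SteinerEcc

infixr:60 ";;" => Prog.seq

/-! ### Searching the graph from the root

The search puts the vertices into a queue, array `3`, and stores the parents, increased by `1`, in
array `2`. -/

/-- Registers `0`, `1`, `2` and arrays `0`, `1` of `s` are those of `s₀`. -/
structure SameInput (s s₀ : State) : Prop where
  reg0 : s.reg 0 = s₀.reg 0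
  reg1 : s.reg 1 = s₀.reg 1
  reg2 : s.reg 2 = s₀.reg 2
  arr0 : s.arr 0 = s₀.arr 0
  arr1 : s.arr 1 = s₀.arr 1

/-- `x` is among the first `m` entries of `q`. -/
def Within {α : Type*} (q : ℕ → α) (m : ℕ) (x : α) : Prop := ∃ j < m, q j = x

variable {n : ℕ} {G : SimpleGraph (Fin n)} {v : Fin n} {p : Fin n → Fin n} {k : ℕ}

/-- The queue `q` of length `m`, stored in `cell`, starts with the root and has every other entry
behind its parent; `mark` holds the parents of the entries, increased by `1`. -/
structure IsQueue (v : Fin n) (p : Fin n → Fin n) (q : ℕ → Fin n) (m : ℕ) (mark cell : ℕ → ℕ) :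
    Prop where
  zero : q 0 = v
  pos : 0 < m
  inj : Set.InjOn q (Set.Iio m)
  cells : ∀ j < m, cell j = q j
  -- The shift by `1` leaves the mark `0` for vertices not yet reached.
  marked : ∀ w, Within q m w → mark w = p w + 1
  unmarked : ∀ w : Fin n, ¬ Within q m w → mark w = 0
  order : ∀ j < m, q j ≠ v → Within q j (p (q j))

theorem within_update {α : Type*} {q : ℕ → α} {m : ℕ} {w x : α} :
    Within (Function.update q m w) (m + 1) x ↔ Within q m x ∨ x = w := by
  constructor
  · rintro ⟨j, hj, h⟩
    rcases Nat.lt_succ_iff_lt_or_eq.1 hj with hj | rfl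
    · exact .inl ⟨j, hj, by rwa [Function.update_of_ne hj.ne] at h⟩
    · exact .inr (by rwa [Function.update_self, eq_comm] at h)
  · rintro (⟨j, hj, h⟩ | rfl)
    · exact ⟨j, by omega, by rwa [Function.update_of_ne hj.ne]⟩
    · exact ⟨m, by omega, Function.update_self ..⟩

theorem within_congr {α : Type*} {q q' : ℕ → α} {m : ℕ} (h : ∀ j < m, q j = q' j) {x : α} :
    Within q m x ↔ Within q' m x :=
  exists_congr fun j => and_congr_right fun hj => by rw [h j hj]

theorem within_succ {α : Type*} {q : ℕ → α} {m : ℕ} {x : α} :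
    Within q (m + 1) x ↔ Within q m x ∨ x = q m := by
  rw [← within_update, Function.update_eq_self]

theorem Within.mono {α : Type*} {q : ℕ → α} {m m' : ℕ} {x : α} (h : Within q m x) (hm : m ≤ m') :
    Within q m' x := by
  obtain ⟨j, hj, h⟩ := h
  exact ⟨j, by omega, h⟩

theorem IsQueue.le {q : ℕ → Fin n} {m : ℕ} {mark cell : ℕ → ℕ} (h : IsQueue v p q m mark cell) :
    m ≤ n := by
  have := Finset.card_le_card_of_injOn (s := Finset.range m) (t := Finset.univ) q (by simp)
    (by simpa using h.inj)
  simpa using this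

theorem IsQueue.push {q : ℕ → Fin n} {m : ℕ} {mark cell : ℕ → ℕ} (h : IsQueue v p q m mark cell)
    {w : Fin n} (hw : ¬ Within q m w) (hpw : Within q m (p w)) :
    IsQueue v p (Function.update q m w) (m + 1) (Function.update mark w (p w + 1))
      (Function.update cell m w) where
  zero := by rw [Function.update_of_ne h.pos.ne, h.zero]
  pos := by omega
  inj := by
    intro a ha b hb hab
    rw [Set.mem_Iio] at ha hb
    simp only [Function.update_apply] at hab
    split_ifs at hab with h₁ h₂ h₂
    · omega
    · exact absurd ⟨b, by omega, hab.symm⟩ hw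
    · exact absurd ⟨a, by omega, hab⟩ hw
    · exact h.inj (show a < m by omega) (show b < m by omega) hab
  cells j hj := by
    simp only [Function.update_apply]
    split_ifs with h₁
    · rfl
    · exact h.cells j (by omega)
  marked x hx := by
    rw [within_update] at hx
    simp only [Function.update_apply, Fin.val_inj]
    split_ifs with h₁
    · rw [h₁]
    · exact h.marked x (hx.resolve_right h₁)
  unmarked x hx := by
    rw [within_update, not_or] at hx
    rw [Function.update_of_ne (Fin.val_injective.ne hx.2)]
    exact h.unmarked x hx.1
  order j hj hne := by
    rcases Nat.lt_succ_iff_lt_or_eq.1 hj with hj | rfl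
    · rw [Function.update_of_ne hj.ne] at hne ⊢
      refine (within_congr fun i hi => ?_).1 (h.order j hj hne)
      rw [Function.update_of_ne (by omega)]
    · rw [Function.update_self]
      exact (within_congr fun i hi => by rw [Function.update_of_ne hi.ne]).1 hpw

/-- Scan the list of the vertex at the head of the queue (register `6` holds this vertex, increased
by `1`) and put the new vertices into the queue. -/
def scan : Prog :=
  .loop (.lt 7 8) (.load 9 1 7 ;; .load 10 2 9 ;;
    .cond (.eq 10 11) (.store 2 9 6 ;; .store 3 5 9 ;; .inc 5) .skip ;; .inc 7)

theorem Holds.exists_adj {s : State} (hs : Holds s v G k) {u : Fin n} {i : ℕ}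
    (h₁ : s.arr 0 u ≤ i) (h₂ : i < s.arr 0 ((u : ℕ) + 1)) :
    ∃ w : Fin n, s.arr 1 i = w ∧ G.Adj u w := by
  obtain ⟨w, hw, h⟩ := (hs.lists u).mapsTo ⟨h₁, h₂⟩
  exact ⟨w, h.symm, hw⟩

theorem Holds.exists_cell {s : State} (hs : Holds s v G k) {u w : Fin n} (h : G.Adj u w) :
    ∃ i, s.arr 0 u ≤ i ∧ i < s.arr 0 ((u : ℕ) + 1) ∧ s.arr 1 i = w := by
  obtain ⟨i, hi, h⟩ := (hs.lists u).surjOn ⟨w, h, rfl⟩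
  exact ⟨i, hi.1, hi.2, h⟩

/-- A neighbour of the head of the queue that is not in the queue is a child of the head. -/
theorem IsQueue.parent_eq (hp : IsParentMap G v p) {q : ℕ → Fin n} {m head : ℕ}
    {mark cell : ℕ → ℕ} (h : IsQueue v p q m mark cell) (hm : head < m)
    (hclosed : ∀ x, x ≠ v → Within q head (p x) → Within q m x)
    (hhead : q head ≠ v → Within q head (p (q head)))
    {w : Fin n} (hw : ¬ Within q m w) (hadj : G.Adj (q head) w) : p w = q head := by
  have hwv : w ≠ v := by rintro rfl; exact hw ⟨0, h.pos, h.zero⟩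
  -- A parent of the head is queued before it. A sibling has its parent before the head, where all
  -- children have already been queued. Only a child can be new; the root, with `p v = v`, is
  -- treated apart.
  rcases hp.edge _ _ hadj with hpu | hpu | hpu
  · by_cases hu : q head = v
    · rw [hu, hp.root] at hpu
      exact absurd hpu.symm hwv
    · exact absurd (hpu ▸ (hhead hu).mono hm.le) hw
  · exact hpu
  · by_cases hu : q head = v
    · rw [hu, hp.root] at hpu
      rw [hu, hpu]
    · exact absurd (hclosed w hwv (hpu ▸ hhead hu)) hw

/-- Apart from the root, the queue holds the children of the vertices already treated and those
children of the head met in the part of its list read so far. An iteration costs at most `8` steps: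
two tests, two loads, three instructions to enqueue and one increment. -/
theorem wp_scan (hp : IsParentMap G v p) {s₀ : State} (hs₀ : Holds s₀ v G k) {s : State}
    (hin : SameInput s s₀) {q : ℕ → Fin n} {head tail : ℕ}
    (hq : IsQueue v p q tail (s.arr 2) (s.arr 3)) (hlt : head < tail)
    (hclosed : ∀ x, x ≠ v → (Within q tail x ↔ Within q head (p x)))
    (h4 : s.reg 4 = head) (h5 : s.reg 5 = tail) (h6 : s.reg 6 = q head + 1)
    (h7 : s.reg 7 = s₀.arr 0 (q head)) (h8 : s.reg 8 = s₀.arr 0 ((q head : ℕ) + 1))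
    (h11 : s.reg 11 = 0) :
    WP scan (fun t s' => SameInput s' s₀ ∧ s'.reg 4 = head ∧ s'.reg 11 = 0 ∧ ∃ q' tail',
      (∀ j ≤ head, q' j = q j) ∧ s'.reg 5 = tail' ∧ head < tail' ∧
      IsQueue v p q' tail' (s'.arr 2) (s'.arr 3) ∧
      (∀ x, x ≠ v → (Within q' tail' x ↔ Within q' (head + 1) (p x))) ∧
      t ≤ 8 * (s₀.arr 0 ((q head : ℕ) + 1) - s₀.arr 0 (q head)) + 1) s := by
  set u := q head with hu
  refine WP.loop (fun t s' => SameInput s' s₀ ∧ s'.reg 4 = head ∧ s'.reg 11 = 0 ∧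
    s'.reg 6 = u + 1 ∧ s'.reg 8 = s₀.arr 0 ((u : ℕ) + 1) ∧
    s₀.arr 0 u ≤ s'.reg 7 ∧ s'.reg 7 ≤ s₀.arr 0 ((u : ℕ) + 1) ∧
    t ≤ 8 * (s'.reg 7 - s₀.arr 0 u) ∧
    ∃ q', (∀ j ≤ head, q' j = q j) ∧ head < s'.reg 5 ∧
      IsQueue v p q' (s'.reg 5) (s'.arr 2) (s'.arr 3) ∧
      (∀ x, x ≠ v → (Within q' (s'.reg 5) x ↔ Within q head (p x) ∨
        p x = u ∧ ∃ l, s₀.arr 0 u ≤ l ∧ l < s'.reg 7 ∧ s₀.arr 1 l = x)))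
    (fun s' => s₀.arr 0 ((u : ℕ) + 1) - s'.reg 7) ?_ ?_ ?_
  · rintro t s' ⟨hin, h4, h11, h6, h8, h7, h7', ht, q', hqq, hlt, hq, hc⟩ htest
    have hi : s'.reg 7 < s₀.arr 0 ((u : ℕ) + 1) := by simpa [Test.Holds, h8] using htest
    obtain ⟨w, hw, hadj⟩ := hs₀.exists_adj h7 hi
    have hw' : s'.arr 1 (s'.reg 7) = w := by rw [hin.arr1, hw]
    have hwithin : ∀ x, Within q' head x ↔ Within q head x := fun x =>
      within_congr fun j hj => hqq j hj.le
    have hbound : ∀ x : Fin n, (∃ l, s₀.arr 0 u ≤ l ∧ l ≤ s'.reg 7 ∧ s₀.arr 1 l = x) ↔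
        (∃ l, s₀.arr 0 u ≤ l ∧ l < s'.reg 7 ∧ s₀.arr 1 l = x) ∨ x = w := by
      intro x
      constructor
      · rintro ⟨l, hl, hl', h⟩
        rcases hl'.lt_or_eq with hl' | rfl
        · exact .inl ⟨l, hl, hl', h⟩
        · exact .inr (Fin.val_injective (h.symm.trans hw))
      · rintro (⟨l, hl, hl', h⟩ | rfl)
        · exact ⟨l, hl, by omega, h⟩
        · exact ⟨_, h7, by omega, hw⟩
    simp only [WP, Test.Holds]
    constructor
    · intro hz
      simp [State.setReg, hw', h11] at hz
      have hnw : ¬ Within q' (s'.reg 5) w := fun h => by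
        have := hq.marked w h
        omega
      have hpw : p w = u := by
        rw [hu, ← hqq head le_rfl]
        refine hq.parent_eq hp hlt (fun x hx h => ?_) (fun hne => hq.order head hlt hne) hnw ?_
        · exact (hc x hx).2 (.inl ((hwithin _).1 h))
        · rwa [hqq head le_rfl]
      have hq' := hq.push hnw ⟨head, hlt, by rw [hqq head le_rfl, hpw]⟩
      simp only [State.setReg, State.setArr, Function.update_apply]
      simp [hw', h6]
      refine ⟨⟨⟨hin.reg0, hin.reg1, hin.reg2, by simpa using hin.arr0, by simpa using hin.arr1⟩,
        h4, h11, h8, by omega, by omega, by omega, Function.update q' (s'.reg 5) w, ?_, by omega,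
        ?_, ?_⟩, by omega⟩
      · intro j hj
        rw [Function.update_of_ne (by omega), hqq j hj]
      · rw [hpw] at hq'
        simpa using hq'
      · intro x hx
        rw [within_update, hc x hx, hbound]
        constructor
        · rintro ((h | h) | rfl)
          · exact .inl h
          · exact .inr ⟨h.1, .inl h.2⟩
          · exact .inr ⟨hpw, .inr rfl⟩
        · rintro (h | ⟨h, h' | h'⟩)
          · exact .inl (.inl h)
          · exact .inl (.inr ⟨h, h'⟩)
          · exact .inr h'
    · intro hz
      simp [State.setReg, hw', h11] at hz
      have hnw : Within q' (s'.reg 5) w := by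
        by_contra h
        exact hz (hq.unmarked w h)
      simp only [State.setReg, Function.update_apply]
      simp
      refine ⟨⟨⟨hin.reg0, hin.reg1, hin.reg2, hin.arr0, hin.arr1⟩,
        h4, h11, h6, h8, by omega, by omega, by omega, q', hqq, hlt, hq, ?_⟩, by omega⟩
      intro x hx
      rw [hc x hx, hbound]
      constructor
      · rintro (h | h)
        · exact .inl h
        · exact .inr ⟨h.1, .inl h.2⟩
      · rintro (h | ⟨h, h' | rfl⟩)
        · exact .inl h
        · exact .inr ⟨h, h'⟩
        · exact (hc x hx).1 hnw
  · refine ⟨hin, h4, h11, h6, h8, h7.ge, ?_, by omega, q, fun _ _ => rfl, by omega, ?_, ?_⟩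
    · rw [h7]; exact hs₀.mono u
    · rwa [h5]
    · intro x hx
      rw [h5, hclosed x hx, h7]
      refine (or_iff_left ?_).symm
      rintro ⟨-, l, h₁, h₂, -⟩
      omega
  · rintro t s' ⟨hin, h4, h11, h6, h8, h7, h7', ht, q', hqq, hlt, hq, hc⟩ htest
    have hi : s'.reg 7 = s₀.arr 0 ((u : ℕ) + 1) := by
      simp only [Test.Holds, h8] at htest; omega
    refine ⟨hin, h4, h11, q', s'.reg 5, hqq, rfl, hlt, hq, fun x hx => ?_, by omega⟩
    rw [hc x hx, within_succ, within_congr (fun j hj => hqq j hj.le), hqq head le_rfl, hi]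
    refine or_congr_right (and_iff_left_of_imp fun hpx => ?_)
    exact hs₀.exists_cell (hpx ▸ (hp.adj x hx).symm)

end RAM

namespace RAM

open SteinerEcc

variable {n : ℕ} {G : SimpleGraph (Fin n)} {v : Fin n} {p : Fin n → Fin n} {k : ℕ}

/-- Set the first `n` cells of array `a` to the content of register `11`. -/
def fill (a : ℕ) : Prog :=
  .const 4 0 ;; .loop (.lt 4 0) (.store a 4 11 ;; .inc 4)

theorem wp_fill {s : State} {a : ℕ} :
    WP (fill a) (fun t s' => (∀ x, x ≠ 4 → s'.reg x = s.reg x) ∧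
      (∀ b, b ≠ a → s'.arr b = s.arr b) ∧ (∀ i < s.reg 0, s'.arr a i = s.reg 11) ∧
      t ≤ 3 * s.reg 0 + 2) s := by
  refine WP.loop (fun t s' => (∀ x, x ≠ 4 → s'.reg x = s.reg x) ∧
      (∀ b, b ≠ a → s'.arr b = s.arr b) ∧ (∀ i < s'.reg 4, s'.arr a i = s.reg 11) ∧
      s'.reg 4 ≤ s.reg 0 ∧ t ≤ 3 * s'.reg 4) (fun s' => s.reg 0 - s'.reg 4) ?_ ?_ ?_
  · rintro t s' ⟨hr, ha, hi, hle, ht⟩ htest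
    simp only [Test.Holds, hr 0 (by omega)] at htest
    simp only [WP, State.setReg, State.setArr]
    simp
    refine ⟨⟨fun x hx => ?_, fun b hb => ?_, fun i hi' => ?_, by omega, by omega⟩, by omega⟩
    · rw [Function.update_of_ne hx, hr x hx]
    · rw [Function.update_of_ne hb, ha b hb]
    · rw [Function.update_apply]
      split_ifs with h
      · exact hr 11 (by omega)
      · exact hi i (by omega)
  · simp only [State.setReg]
    simp +contextual
  · rintro t s' ⟨hr, ha, hi, hle, ht⟩ htest
    simp only [Test.Holds, hr 0 (by omega)] at htest
    refine ⟨hr, ha, fun i h => hi i (by omega), by omega⟩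

/-- Treat all vertices of the queue. -/
def scanAll : Prog :=
  .loop (.lt 4 5) (.load 6 3 4 ;; .load 7 0 6 ;; .inc 6 ;; .load 8 0 6 ;; scan ;; .inc 4)

/-- Search the graph from the root. -/
def search : Prog :=
  -- Memory is arbitrary at the start, so the marks must be cleared.
  .const 11 0 ;; fill 2 ;; .copy 6 1 ;; .inc 6 ;; .store 2 1 6 ;; .const 4 0 ;; .store 3 4 1 ;;
    .const 5 1 ;; scanAll

/-- The queue `q` contains all vertices. -/
structure Searched (v : Fin n) (p : Fin n → Fin n) (s : State) (q : ℕ → Fin n) : Prop where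
  queue : IsQueue v p q n (s.arr 2) (s.arr 3)
  within : ∀ x, Within q n x

theorem IsQueue.sum_le {q : ℕ → Fin n} {m : ℕ} {mark cell : ℕ → ℕ} (h : IsQueue v p q m mark cell)
    (f : Fin n → ℕ) : ∑ j ∈ Finset.range m, f (q j) ≤ ∑ u, f u := by
  classical
  rw [← Finset.sum_image (f := f) (s := Finset.range m) (g := q)
    (fun a ha b hb => h.inj (by simpa using ha) (by simpa using hb))]
  exact Finset.sum_le_sum_of_subset (Finset.subset_univ _)

theorem wp_scanAll (hp : IsParentMap G v p) {s₀ : State} (hs₀ : Holds s₀ v G k) {s : State}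
    (hin : SameInput s s₀) {q : ℕ → Fin n} (hq : IsQueue v p q 1 (s.arr 2) (s.arr 3))
    (h4 : s.reg 4 = 0) (h5 : s.reg 5 = 1) (h11 : s.reg 11 = 0) :
    WP scanAll (fun t s' => SameInput s' s₀ ∧ (∃ q', Searched v p s' q') ∧
      t ≤ 8 * ∑ u : Fin n, (s₀.arr 0 ((u : ℕ) + 1) - s₀.arr 0 u) + 7 * n + 1) s := by
  refine WP.loop (fun t s' => SameInput s' s₀ ∧ s'.reg 11 = 0 ∧ s'.reg 4 ≤ s'.reg 5 ∧
    ∃ q', IsQueue v p q' (s'.reg 5) (s'.arr 2) (s'.arr 3) ∧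
      (∀ x, x ≠ v → (Within q' (s'.reg 5) x ↔ Within q' (s'.reg 4) (p x))) ∧
      t ≤ 8 * ∑ j ∈ Finset.range (s'.reg 4),
        (s₀.arr 0 ((q' j : ℕ) + 1) - s₀.arr 0 (q' j)) + 7 * s'.reg 4)
    (fun s' => n - s'.reg 4) ?_ ?_ ?_
  · rintro t s' ⟨hin, h11, hle, q', hq, hc, ht⟩ htest
    have hlt : s'.reg 4 < s'.reg 5 := htest
    have hn := hq.le
    have hcell := hq.cells _ hlt
    simp only [WP]
    refine (wp_scan hp hs₀ (q := q') (head := s'.reg 4) (tail := s'.reg 5)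
      ?_ ?_ hlt hc ?_ ?_ ?_ ?_ ?_ ?_).mono ?_
    · exact ⟨hin.reg0, hin.reg1, hin.reg2, hin.arr0, hin.arr1⟩
    · exact hq
    · simp [State.setReg]
    · simp [State.setReg]
    · simp [State.setReg, hcell]
    · simp [State.setReg, hcell, hin.arr0]
    · simp [State.setReg, hcell, hin.arr0]
    · simp [State.setReg, h11]
    · rintro t' s'' ⟨hin', h4', h11', q'', tail, hqq, h5', hlt', hq', hc', ht'⟩
      simp only [State.setReg]
      simp
      refine ⟨⟨⟨hin'.reg0, hin'.reg1, hin'.reg2, hin'.arr0, hin'.arr1⟩, h11', by omega, q'', ?_,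
        ?_, ?_⟩, by omega⟩
      · rwa [h5']
      · rw [h4', h5']
        simpa using hc'
      · rw [h4', Finset.sum_range_succ, Finset.sum_congr rfl (g := fun j =>
          s₀.arr 0 ((q' j : ℕ) + 1) - s₀.arr 0 (q' j)) (fun j hj => by
            rw [hqq j (Finset.mem_range.1 hj).le]), hqq _ le_rfl]
        omega
  · refine ⟨hin, h11, by omega, q, by rwa [h5], fun x hx => ?_, by simp⟩
    rw [h4, h5]
    constructor
    · rintro ⟨j, hj, rfl⟩
      obtain rfl : j = 0 := by omega
      exact absurd hq.zero hx
    · rintro ⟨j, hj, -⟩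
      omega
  · rintro t s' ⟨hin, h11, hle, q', hq, hc, ht⟩ htest
    have heq : s'.reg 4 = s'.reg 5 := by
      simp only [Test.Holds] at htest
      omega
    -- With head and tail equal, the queue contains every child of its entries, hence every vertex,
    -- by induction on the number of steps to the root.
    have hall : ∀ x, Within q' (s'.reg 5) x := by
      intro x
      obtain ⟨i, hi⟩ := hp.reach x
      induction i generalizing x with
      | zero =>
        rw [show x = v from hi]
        exact ⟨0, hq.pos, hq.zero⟩
      | succ i ih =>
        by_cases hx : x = v
        · rw [hx]
          exact ⟨0, hq.pos, hq.zero⟩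
        · exact (hc x hx).2 (heq ▸ ih (p x) hi)
    have hn : s'.reg 5 = n := by
      refine le_antisymm hq.le ?_
      have := Finset.card_le_card_of_surjOn (s := Finset.range (s'.reg 5))
        (t := (Finset.univ : Finset (Fin n))) q' (fun x _ => by
          obtain ⟨j, hj, h⟩ := hall x
          exact ⟨j, by simpa using hj, h⟩)
      simpa using this
    rw [hn] at hq hall heq
    refine ⟨hin, ⟨q', hq, hall⟩, ?_⟩
    have := hq.sum_le (fun u => s₀.arr 0 ((u : ℕ) + 1) - s₀.arr 0 u)
    rw [heq] at ht
    omega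

theorem wp_search (hp : IsParentMap G v p) {s : State} (hs : Holds s v G k) :
    WP search (fun t s' => SameInput s' s ∧ (∃ q, Searched v p s' q) ∧
      t ≤ 8 * ∑ u : Fin n, (s.arr 0 ((u : ℕ) + 1) - s.arr 0 u) + 10 * n + 10) s := by
  simp only [search, WP]
  refine wp_fill.mono ?_
  rintro t s' ⟨hr, ha, hi, ht⟩
  simp [State.setReg] at hr ha hi ht
  refine (wp_scanAll hp hs (q := fun _ => v) ?_ ?_ ?_ ?_ ?_).mono ?_
  · constructor <;> simp [State.setReg, State.setArr, hr, ha]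
  · have hv : s'.reg 1 = v := by rw [hr 1 (by omega)]; simp [hs.vertex]
    constructor
    · rfl
    · omega
    · intro a ha b hb _
      rw [Set.mem_Iio] at ha hb
      omega
    · intro j hj
      obtain rfl : j = 0 := by omega
      simp [State.setReg, State.setArr, hv]
    · rintro w ⟨_, _, rfl⟩
      simp [State.setReg, State.setArr, hv, hp.root]
    · intro w hw
      have hwv : (w : ℕ) ≠ v := fun h => hw ⟨0, by omega, (Fin.val_injective h).symm⟩
      have := hi w (by rw [hs.order]; exact w.2)
      simp [State.setReg, State.setArr, hv, Function.update_of_ne hwv, this]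
    · intro j _ h
      exact absurd rfl h
  · simp [State.setReg, State.setArr]
  · simp [State.setReg, State.setArr]
  · simp [State.setReg, State.setArr, hr 11]
  · rintro t' s'' ⟨h₁, h₂, h₃⟩
    refine ⟨h₁, h₂, ?_⟩
    rw [hs.order] at ht
    omega

/-- The lists have twice as many cells as the graph has edges. -/
theorem Holds.sum_length {s : State} (hs : Holds s v G k) :
    ∑ u : Fin n, (s.arr 0 ((u : ℕ) + 1) - s.arr 0 u) = 2 * G.edgeSet.ncard := by
  classical
  have hdeg : ∀ u : Fin n, s.arr 0 ((u : ℕ) + 1) - s.arr 0 u = G.degree u := by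
    intro u
    have h := (hs.lists u).image_eq
    have h' := congrArg Set.ncard h
    rw [(hs.lists u).injOn.ncard_image,
      Set.ncard_image_of_injective _ Fin.val_injective, Set.ncard_eq_toFinset_card',
      Set.ncard_eq_toFinset_card', Set.toFinset_Ico, Nat.card_Ico] at h'
    exact h'
  rw [Finset.sum_congr rfl fun u _ => hdeg u, G.sum_degrees_eq_twice_card_edges,
    Set.ncard_eq_toFinset_card', SimpleGraph.edgeFinset]

end RAM

namespace RAM

open SteinerEcc

variable {n : ℕ} {G T : SimpleGraph (Fin n)} {v : Fin n} {p : Fin n → Fin n} {k : ℕ}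

/-! ### Removing edges from the adjacency lists -/

/-- Copy the cell read to the next cell to be written. -/
def keep : Prog := .store 1 5 9 ;; .inc 5

/-- Remove from the list of the vertex in register `4` all but its parent and its children. -/
def pruneList : Prog :=
  .loop (.lt 7 8) (.load 9 1 7 ;; .load 10 2 9 ;; .load 12 2 4 ;; .copy 13 9 ;; .inc 13 ;;
    .cond (.eq 10 6) keep (.cond (.eq 12 13) keep .skip) ;; .inc 7)

/-- Remove from all lists all but the parents and the children. -/
def prune : Prog :=
  .const 4 0 ;; .const 5 0 ;; .const 7 0 ;;
    .loop (.lt 4 0) (.copy 6 4 ;; .inc 6 ;; .load 8 0 6 ;; pruneList ;; .store 0 6 5 ;; .copy 4 6)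

theorem bijOn_update_Ico {f : ℕ → ℕ} {a m x : ℕ} {S : Set ℕ} (h : Set.BijOn f (Set.Ico a m) S)
    (ham : a ≤ m) (hx : x ∉ S) :
    Set.BijOn (Function.update f m x) (Set.Ico a (m + 1)) (insert x S) := by
  have h' : Set.BijOn (Function.update f m x) (Set.Ico a m) S :=
    h.congr fun i hi => by rw [Function.update_of_ne hi.2.ne]
  have hI : Set.Ico a (m + 1) = insert m (Set.Ico a m) := by
    ext i
    simp only [Set.mem_Ico, Set.mem_insert_iff]
    omega
  have := h'.insert (a := m) (by simpa using hx)
  rwa [Function.update_self, ← hI] at this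

/-- The list is compacted in place: the writing position never passes the reading position, so
unread cells are still the original ones. -/
theorem wp_pruneList (hTG : T ≤ G) (hT : ∀ u w, T.Adj u w ↔ u ≠ w ∧ (p u = w ∨ p w = u))
    {s₀ : State} (hs₀ : Holds s₀ v G k) {s : State} (hpar : ∀ w : Fin n, s.arr 2 w = p w + 1)
    {u : Fin n} (h4 : s.reg 4 = u) (h6 : s.reg 6 = u + 1) (h7 : s.reg 7 = s₀.arr 0 u)
    (h8 : s.reg 8 = s₀.arr 0 ((u : ℕ) + 1)) (h57 : s.reg 5 ≤ s.reg 7)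
    (h1 : ∀ x, s.reg 7 ≤ x → s.arr 1 x = s₀.arr 1 x) :
    WP pruneList (fun t s' => s'.arr 0 = s.arr 0 ∧ s'.arr 2 = s.arr 2 ∧
      (∀ x, x = 0 ∨ x = 1 ∨ x = 2 ∨ x = 4 ∨ x = 6 ∨ x = 8 → s'.reg x = s.reg x) ∧
      s'.reg 7 = s₀.arr 0 ((u : ℕ) + 1) ∧
      s.reg 5 ≤ s'.reg 5 ∧ s'.reg 5 ≤ s'.reg 7 ∧ (∀ x < s.reg 5, s'.arr 1 x = s.arr 1 x) ∧
      (∀ x, s'.reg 7 ≤ x → s'.arr 1 x = s₀.arr 1 x) ∧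
      Set.BijOn (s'.arr 1) (Set.Ico (s.reg 5) (s'.reg 5)) (Fin.val '' T.neighborSet u) ∧
      t ≤ 11 * (s₀.arr 0 ((u : ℕ) + 1) - s₀.arr 0 u) + 1) s := by
  refine WP.loop (fun t s' => s'.arr 0 = s.arr 0 ∧ s'.arr 2 = s.arr 2 ∧
      (∀ x, x = 0 ∨ x = 1 ∨ x = 2 ∨ x = 4 ∨ x = 6 ∨ x = 8 → s'.reg x = s.reg x) ∧
      s₀.arr 0 u ≤ s'.reg 7 ∧ s'.reg 7 ≤ s₀.arr 0 ((u : ℕ) + 1) ∧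
      s.reg 5 ≤ s'.reg 5 ∧ s'.reg 5 ≤ s'.reg 7 ∧ (∀ x < s.reg 5, s'.arr 1 x = s.arr 1 x) ∧
      (∀ x, s'.reg 7 ≤ x → s'.arr 1 x = s₀.arr 1 x) ∧
      Set.BijOn (s'.arr 1) (Set.Ico (s.reg 5) (s'.reg 5))
        (Fin.val '' {w | T.Adj u w ∧ ∃ l, s₀.arr 0 u ≤ l ∧ l < s'.reg 7 ∧ s₀.arr 1 l = w}) ∧
      t ≤ 11 * (s'.reg 7 - s₀.arr 0 u)) (fun s' => s₀.arr 0 ((u : ℕ) + 1) - s'.reg 7) ?_ ?_ ?_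
  · rintro t s' ⟨ha0, ha2, hr, h7, h7', h5, h57, hlo, hhi, hbij, ht⟩ htest
    have hi : s'.reg 7 < s₀.arr 0 ((u : ℕ) + 1) := by
      simpa [Test.Holds, hr 8, h8] using htest
    obtain ⟨w, hw, hadj⟩ := hs₀.exists_adj h7 hi
    have hw' : s'.arr 1 (s'.reg 7) = w := by rw [hhi _ le_rfl, hw]
    have hnew : (w : ℕ) ∉ Fin.val ''
        {w | T.Adj u w ∧ ∃ l, s₀.arr 0 u ≤ l ∧ l < s'.reg 7 ∧ s₀.arr 1 l = w} := by
      rintro ⟨w', ⟨-, l, hl, hl', h⟩, heq⟩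
      have := (hs₀.lists u).injOn (x₁ := l) (x₂ := s'.reg 7) ⟨hl, by omega⟩ ⟨h7, hi⟩
        (by rw [h, heq, hw])
      omega
    have hset : ∀ w' : Fin n, (∃ l, s₀.arr 0 u ≤ l ∧ l ≤ s'.reg 7 ∧ s₀.arr 1 l = w') ↔
        (∃ l, s₀.arr 0 u ≤ l ∧ l < s'.reg 7 ∧ s₀.arr 1 l = w') ∨ w' = w := by
      intro x
      constructor
      · rintro ⟨l, hl, hl', h⟩
        rcases hl'.lt_or_eq with hl' | rfl
        · exact .inl ⟨l, hl, hl', h⟩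
        · exact .inr (Fin.val_injective (h.symm.trans hw))
      · rintro (⟨l, hl, hl', h⟩ | rfl)
        · exact ⟨l, hl, by omega, h⟩
        · exact ⟨_, h7, by omega, hw⟩
    have hkeep : T.Adj u w →
        (∀ x < s.reg 5, Function.update (s'.arr 1) (s'.reg 5) w x = s.arr 1 x) ∧
        (∀ x, s'.reg 7 < x → Function.update (s'.arr 1) (s'.reg 5) w x = s₀.arr 1 x) ∧
        Set.BijOn (Function.update (s'.arr 1) (s'.reg 5) w) (Set.Ico (s.reg 5) (s'.reg 5 + 1))
          (Fin.val '' {w | T.Adj u w ∧ ∃ l, s₀.arr 0 u ≤ l ∧ l ≤ s'.reg 7 ∧ s₀.arr 1 l = w}) := by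
      intro hTw
      refine ⟨fun x hx => ?_, fun x hx => ?_, ?_⟩
      · rw [Function.update_of_ne (by omega), hlo x hx]
      · rw [Function.update_of_ne (by omega), hhi x hx.le]
      · have := bijOn_update_Ico hbij h5 hnew
        rw [← Set.image_insert_eq] at this
        convert this using 2
        ext x
        simp only [Set.mem_ofPred_eq, Set.mem_insert_iff, hset]
        constructor
        · rintro ⟨h₁, h₂ | h₂⟩
          · exact .inr ⟨h₁, h₂⟩
          · exact .inl h₂
        · rintro (rfl | ⟨h₁, h₂⟩)
          · exact ⟨hTw, .inr rfl⟩
          · exact ⟨h₁, .inl h₂⟩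
    have hp10 : s'.arr 2 w = p w + 1 := by rw [ha2, hpar]
    have hp12 : s'.arr 2 u = p u + 1 := by rw [ha2, hpar]
    have hr4 : s'.reg 4 = u := by rw [hr 4 (by omega), h4]
    have hr6 : s'.reg 6 = u + 1 := by rw [hr 6 (by omega), h6]
    have hregs : s'.reg 0 = s.reg 0 ∧ s'.reg 1 = s.reg 1 ∧ s'.reg 2 = s.reg 2 ∧
        s'.reg 4 = s.reg 4 ∧ s'.reg 6 = s.reg 6 ∧ s'.reg 8 = s.reg 8 := by
      simpa using hr
    simp only [WP, Test.Holds, keep]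
    refine ⟨fun h => ?_, fun h => ⟨fun h' => ?_, fun h' => ?_⟩⟩
    · simp [State.setReg, hw', hp10, hr6] at h
      have hTw : T.Adj u w := (hT u w).2 ⟨hadj.ne, .inr (Fin.val_injective h)⟩
      obtain ⟨hk₁, hk₂, hk₃⟩ := hkeep hTw
      simp only [State.setReg, State.setArr]
      simp [hw']
      refine ⟨⟨ha0, ha2, hregs, by omega, by omega, by omega, h57, hk₁,
        fun x hx => hk₂ x (by omega), hk₃, by omega⟩, by omega⟩
    · simp [State.setReg, hw', hp12, hr4] at h'
      have hTw : T.Adj u w := (hT u w).2 ⟨hadj.ne, .inl (Fin.val_injective h')⟩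
      obtain ⟨hk₁, hk₂, hk₃⟩ := hkeep hTw
      simp only [State.setReg, State.setArr]
      simp [hw']
      refine ⟨⟨ha0, ha2, hregs, by omega, by omega, by omega, h57, hk₁,
        fun x hx => hk₂ x (by omega), hk₃, by omega⟩, by omega⟩
    · simp [State.setReg, hw', hp10, hr6] at h
      simp [State.setReg, hw', hp12, hr4] at h'
      have hTw : ¬ T.Adj u w := by
        rw [hT]
        rintro ⟨-, rfl | rfl⟩
        · exact h' rfl
        · exact h rfl
      simp only [State.setReg]
      simp
      refine ⟨⟨ha0, ha2, hregs, by omega, by omega, by omega, by omega, hlo,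
        fun x hx => hhi x (by omega), ?_, by omega⟩, by omega⟩
      convert hbij using 2
      ext x
      simp only [Set.mem_ofPred_eq, hset]
      refine and_congr_right fun hx => or_iff_left ?_
      rintro rfl
      exact hTw hx
  · refine ⟨rfl, rfl, fun _ _ => rfl, h7.ge, h7 ▸ hs₀.mono u, le_rfl, h57, fun _ _ => rfl, h1, ?_,
      by omega⟩
    have hempty : {w : Fin n | T.Adj u w ∧
        ∃ l, s₀.arr 0 u ≤ l ∧ l < s.reg 7 ∧ s₀.arr 1 l = w} = ∅ := by
      ext x
      simp only [Set.mem_ofPred_eq, Set.mem_empty_iff_false, iff_false]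
      rintro ⟨-, l, h₁, h₂, -⟩
      omega
    rw [hempty, Set.Ico_self, Set.image_empty]
    exact Set.bijOn_empty _
  · rintro t s' ⟨ha0, ha2, hr, h7, h7', h5, h57, hlo, hhi, hbij, ht⟩ htest
    have hi : s'.reg 7 = s₀.arr 0 ((u : ℕ) + 1) := by
      simp only [Test.Holds, hr 8 (by omega), h8] at htest; omega
    refine ⟨ha0, ha2, hr, hi, h5, h57, hlo, hhi, ?_, by omega⟩
    convert hbij using 2
    ext x
    rw [hi]
    exact (and_iff_left_of_imp fun hx => hs₀.exists_cell (hTG hx)).symm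

/-- Overwriting a start in array `0` does no harm: register `7` still holds the old start of the
next list, and finished lists lie below the writing position. -/
theorem wp_prune (hTG : T ≤ G) (hT : ∀ u w, T.Adj u w ↔ u ≠ w ∧ (p u = w ∨ p w = u))
    {s : State} (hs : Holds s v G k) (hpar : ∀ w : Fin n, s.arr 2 w = p w + 1) :
    WP prune (fun t s' => Holds s' v T k ∧
      t ≤ 11 * ∑ u : Fin n, (s.arr 0 ((u : ℕ) + 1) - s.arr 0 u) + 7 * n + 4) s := by
  simp only [prune, WP.seq_iff, WP.const_iff]
  refine WP.loop (fun t s' => s'.reg 0 = n ∧ s'.reg 1 = v ∧ s'.reg 2 = k ∧ s'.arr 2 = s.arr 2 ∧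
    s'.reg 4 ≤ n ∧ s'.reg 7 = s.arr 0 (s'.reg 4) ∧ s'.reg 5 = s'.arr 0 (s'.reg 4) ∧
    s'.reg 5 ≤ s'.reg 7 ∧ (∀ x, s'.reg 4 < x → s'.arr 0 x = s.arr 0 x) ∧
    (∀ x, s'.reg 7 ≤ x → s'.arr 1 x = s.arr 1 x) ∧ s'.arr 0 0 = 0 ∧
    (∀ y ≤ s'.reg 4, s'.arr 0 y ≤ s'.reg 5) ∧
    (∀ y : Fin n, (y : ℕ) < s'.reg 4 → s'.arr 0 y ≤ s'.arr 0 ((y : ℕ) + 1) ∧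
      Set.BijOn (s'.arr 1) (Set.Ico (s'.arr 0 y) (s'.arr 0 ((y : ℕ) + 1)))
        (Fin.val '' T.neighborSet y)) ∧
    t ≤ 11 * ∑ y ∈ Finset.range (s'.reg 4), (s.arr 0 (y + 1) - s.arr 0 y) + 7 * s'.reg 4)
    (fun s' => n - s'.reg 4) ?_ ?_ ?_
  · rintro t s' ⟨h0, h1, h2, ha2, h4, h7, h5, h57, ha0, ha1, hz, hle, hdone, ht⟩ htest
    have hlt : s'.reg 4 < n := by simpa [Test.Holds, h0] using htest
    obtain ⟨u, hu⟩ : ∃ u : Fin n, s'.reg 4 = u := ⟨⟨s'.reg 4, hlt⟩, rfl⟩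
    simp only [WP]
    refine (wp_pruneList hTG hT hs (u := u) ?_ ?_ ?_ ?_ ?_ ?_ ?_).mono ?_
    · intro w
      simp [State.setReg, ha2, hpar]
    · simp [State.setReg, hu]
    · simp [State.setReg, hu]
    · simp [State.setReg, h7, hu]
    · simp [State.setReg, hu, ha0]
    · simpa [State.setReg] using h57
    · simpa [State.setReg] using ha1
    · rintro t' s'' ⟨hb0, hb2, hr, hb7, hb5, hb57, hlo, hhi, hbij, ht'⟩
      simp [State.setReg] at hb0 hb2 hb5 hlo hbij
      have hr0 : s''.reg 0 = n := by rw [hr 0 (by omega)]; simp [State.setReg, h0]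
      have hr1 : s''.reg 1 = v := by rw [hr 1 (by omega)]; simp [State.setReg, h1]
      have hr2 : s''.reg 2 = k := by rw [hr 2 (by omega)]; simp [State.setReg, h2]
      have hr6 : s''.reg 6 = u + 1 := by rw [hr 6 (by omega)]; simp [State.setReg, hu]
      rw [hu] at hle hdone h4 h7 h5 ha0 ht hlt
      have hsum := Finset.sum_range_succ (fun y => s.arr 0 (y + 1) - s.arr 0 y) u
      have hother : ∀ y, y ≤ (u : ℕ) →
          Function.update (s'.arr 0) ((u : ℕ) + 1) (s''.reg 5) y = s'.arr 0 y := fun y hy => by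
        rw [Function.update_of_ne (by omega)]
      simp only [State.setReg, State.setArr]
      simp [hr6, hb0]
      refine ⟨⟨hr0, hr1, hr2, by rw [hb2, ha2], hb7, hb57, fun x hx => ?_,
        hhi, hz, fun y hy => ?_, fun y hy => ?_, ?_⟩, by omega⟩
      · rw [Function.update_of_ne (by omega), ha0 x (by omega)]
      · rcases Nat.le_succ_iff.1 hy with hy | rfl
        · rw [hother y hy]
          exact (hle y hy).trans hb5
        · rw [Function.update_self]
      · rcases hy.lt_or_eq with hy | rfl
        · rw [Fin.lt_def] at hy
          rw [hother y hy.le, hother (y + 1) hy]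
          refine ⟨(hdone y hy).1, (hdone y hy).2.congr fun x hx => (hlo x ?_).symm⟩
          exact hx.2.trans_le (hle _ hy)
        · rw [hother y le_rfl, Function.update_self, ← h5]
          exact ⟨hb5, hbij⟩
      · omega
  · simp [State.setReg, hs.order, hs.vertex, hs.param, hs.start]
  · rintro t s' ⟨h0, h1, h2, ha2, h4, h7, h5, h57, ha0, ha1, hz, hle, hdone, ht⟩ htest
    have heq : s'.reg 4 = n := by simp only [Test.Holds, h0] at htest; omega
    rw [heq] at hdone ht
    refine ⟨⟨h0, h1, h2, hz, fun u => (hdone u u.2).1, fun u => (hdone u u.2).2⟩, ?_⟩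
    rw [Fin.sum_univ_eq_sum_range (fun y => s.arr 0 (y + 1) - s.arr 0 y)]
    omega

end RAM

namespace RAM

open SteinerEcc

variable {n : ℕ} {G T : SimpleGraph (Fin n)} {v : Fin n} {p : Fin n → Fin n} {k : ℕ}

/-! ### Heights -/

/-- Run through the queue backwards and update the heights of the parents in array `4`. -/
def heights : Prog :=
  .const 11 0 ;; fill 4 ;; .copy 4 0 ;; .dec 4 ;;
    .loop (.lt 11 4) (.load 6 3 4 ;; .load 7 2 6 ;; .dec 7 ;; .load 8 4 6 ;; .load 9 4 7 ;;
      .cond (.lt 8 9) .skip (.inc 8 ;; .store 4 7 8) ;; .dec 4)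

/-- `H` is the height with respect to the entries of the queue behind position `i`. -/
structure PartialHeight (p : Fin n → Fin n) (q : ℕ → Fin n) (i : ℕ) (H : ℕ → ℕ) : Prop where
  lt : ∀ j, i < j → j < n → H (q j) < H (p (q j))
  child : ∀ (u : Fin n) x, H u = x + 1 → ∃ j, i < j ∧ j < n ∧ p (q j) = u ∧ H (q j) = x
  -- Each entry treated raises the greatest height by at most `1`; at `i = 0` all heights are below
  -- `n`.
  bound : ∀ u : Fin n, H u + i + 1 ≤ n

theorem IsQueue.ne_root {q : ℕ → Fin n} {m : ℕ} {mark cell : ℕ → ℕ}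
    (h : IsQueue v p q m mark cell) {j : ℕ} (h0 : 0 < j) (hj : j < m) : q j ≠ v := by
  intro hv
  have := h.inj (show j < m from hj) (show 0 < m from h.pos) (hv.trans h.zero.symm)
  omega

theorem PartialHeight.pred_of_lt {q : ℕ → Fin n} {i : ℕ} {H : ℕ → ℕ} (h : PartialHeight p q i H)
    (hi : 0 < i) (hlt : H (q i) < H (p (q i))) : PartialHeight p q (i - 1) H where
  lt j h₁ h₂ := by
    rcases eq_or_ne j i with rfl | hne
    · exact hlt
    · exact h.lt j (by omega) h₂
  child u x hx := by
    obtain ⟨j, h₁, h₂⟩ := h.child u x hx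
    exact ⟨j, by omega, h₂⟩
  bound u := by
    have := h.bound u
    omega

/-- A parent stands before its children in the queue, so raising its value changes no entry from
position `i` on. Inequalities with its other children persist, and `q i` becomes the child one
lower. -/
theorem PartialHeight.pred_of_ge {q : ℕ → Fin n} {i : ℕ} {H mark cell : ℕ → ℕ}
    (h : PartialHeight p q i H) (hq : IsQueue v p q n mark cell) (hi : 0 < i) (hin : i < n)
    (hge : H (p (q i)) ≤ H (q i)) :
    PartialHeight p q (i - 1) (Function.update H (p (q i)) (H (q i) + 1)) := by
  have hne : ∀ j, i ≤ j → j < n → q j ≠ p (q i) := by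
    intro j h₁ h₂ heq
    obtain ⟨l, hl, hl'⟩ := hq.order i hin (hq.ne_root hi hin)
    have := hq.inj (show l < n by omega) (show j < n from h₂) (hl'.trans heq.symm)
    omega
  have hsame : ∀ j, i ≤ j → j < n →
      Function.update H (p (q i)) (H (q i) + 1) (q j) = H (q j) := fun j h₁ h₂ =>
    Function.update_of_ne (Fin.val_injective.ne (hne j h₁ h₂)) _ _
  refine ⟨fun j h₁ h₂ => ?_, fun u x hx => ?_, fun u => ?_⟩
  · rw [hsame j (by omega) h₂]
    rcases eq_or_ne j i with rfl | hji
    · rw [Function.update_self]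
      omega
    · have := h.lt j (by omega) h₂
      rw [Function.update_apply]
      split_ifs with h'
      · rw [h'] at this
        omega
      · exact this
  · rw [Function.update_apply] at hx
    split_ifs at hx with h'
    · exact ⟨i, by omega, hin, (Fin.val_injective h').symm, by rw [hsame i le_rfl hin]; omega⟩
    · obtain ⟨j, h₁, h₂, h₃, h₄⟩ := h.child u x hx
      exact ⟨j, by omega, h₂, h₃, by rw [hsame j h₁.le h₂, h₄]⟩
  · have h₁ := h.bound u
    have h₂ := h.bound (q i)
    rw [Function.update_apply]
    split_ifs <;> omega

theorem PartialHeight.isHeight {q : ℕ → Fin n} {H mark cell : ℕ → ℕ}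
    (h : PartialHeight p q 0 H) (hq : IsQueue v p q n mark cell) (hall : ∀ x, Within q n x) :
    IsHeight v p (fun u => H u) where
  lt u hu := by
    obtain ⟨j, hj, rfl⟩ := hall u
    refine h.lt j (Nat.pos_of_ne_zero ?_) hj
    rintro rfl
    exact hu hq.zero
  child u x hx := by
    obtain ⟨j, h₁, h₂, h₃⟩ := h.child u x hx
    exact ⟨q j, hq.ne_root h₁ h₂, h₃⟩

theorem wp_heights {s : State} (h0 : s.reg 0 = n) {q : ℕ → Fin n} (hq : Searched v p s q) :
    WP heights (fun t s' => s'.reg 0 = n ∧ s'.reg 2 = s.reg 2 ∧ Searched v p s' q ∧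
      IsHeight v p (fun u => s'.arr 4 u) ∧ (∀ u : Fin n, s'.arr 4 u < n) ∧
      t ≤ 13 * n + 6) s := by
  have hpos := hq.queue.pos
  simp only [heights, WP.seq_iff, WP.const_iff, WP.copy_iff, WP.dec_iff]
  refine wp_fill.mono ?_
  rintro t s₁ ⟨hr, ha, hi, ht⟩
  simp [State.setReg, h0] at hr ha hi ht
  refine WP.loop (fun t s' => s'.reg 0 = n ∧ s'.reg 2 = s.reg 2 ∧ s'.reg 11 = 0 ∧
    s'.arr 2 = s.arr 2 ∧ s'.arr 3 = s.arr 3 ∧ s'.reg 4 < n ∧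
    PartialHeight p q (s'.reg 4) (s'.arr 4) ∧ t + 10 * s'.reg 4 ≤ 10 * n)
    (fun s' => s'.reg 4) ?_ ?_ ?_
  · rintro t s' ⟨h0, h2, h11, ha2, ha3, h4, hH, ht⟩ htest
    have hlt : 0 < s'.reg 4 := by simpa [Test.Holds, h11] using htest
    have hc : s'.arr 3 (s'.reg 4) = q (s'.reg 4) := by rw [ha3, hq.queue.cells _ h4]
    have hm : s'.arr 2 (q (s'.reg 4)) = p (q (s'.reg 4)) + 1 := by
      rw [ha2, hq.queue.marked _ (hq.within _)]
    simp only [WP, Test.Holds]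
    refine ⟨fun h => ?_, fun h => ?_⟩
    · simp [State.setReg, hc, hm] at h
      simp only [State.setReg]
      simp
      exact ⟨⟨h0, h2, h11, ha2, ha3, by omega, hH.pred_of_lt hlt h, by omega⟩, by omega⟩
    · simp [State.setReg, hc, hm] at h
      simp only [State.setReg, State.setArr]
      simp [hc, hm]
      exact ⟨⟨h0, h2, h11, ha2, ha3, by omega, hH.pred_of_ge hq.queue hlt h4 h, by omega⟩,
        by omega⟩
  · simp [State.setReg, hr, ha, h0, hpos]
    refine ⟨fun j h₁ h₂ => by omega, fun u x hx => ?_, fun u => ?_⟩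
    · simp [hi u u.2] at hx
    · rw [hi u u.2]
      omega
  · rintro t' s' ⟨h0, h2, h11, ha2, ha3, h4, hH, ht'⟩ htest
    have heq : s'.reg 4 = 0 := by
      simp only [Test.Holds, h11] at htest
      omega
    rw [heq] at hH
    refine ⟨h0, h2, ⟨?_, hq.within⟩, hH.isHeight hq.queue hq.within, fun u => ?_, by omega⟩
    · rw [ha2, ha3]
      exact hq.queue
    · exact hH.bound u

/-! ### Counting -/

/-- Count the vertices behind the root in the queue, at most `k - 1` of every height. -/
def count : Prog :=
  .const 11 0 ;; fill 5 ;; .const 3 0 ;; .copy 12 2 ;; .dec 12 ;; .const 4 1 ;;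
    .loop (.lt 4 0) (.load 6 3 4 ;; .load 7 4 6 ;; .load 8 5 7 ;;
      .cond (.lt 8 12) (.inc 8 ;; .store 5 7 8 ;; .inc 3) .skip ;; .inc 4)

/-- The number of positions `j` with `1 ≤ j < i` where `f` has the value `x`. -/
def countUpTo (f : ℕ → ℕ) (i x : ℕ) : ℕ := ∑ j ∈ Finset.Ico 1 i, if f j = x then 1 else 0

theorem countUpTo_succ (f : ℕ → ℕ) {i : ℕ} (hi : 1 ≤ i) (x : ℕ) :
    countUpTo f (i + 1) x = countUpTo f i x + if f i = x then 1 else 0 :=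
  Finset.sum_Ico_succ_top hi _

/-- Only the summand at `f i` can change, and it grows exactly when it is still below `K`; this is
the test made by `count`. -/
theorem sum_min_countUpTo_succ (f : ℕ → ℕ) {i N K : ℕ} (hi : 1 ≤ i) (hN : f i < N) :
    ∑ x ∈ Finset.range N, min K (countUpTo f (i + 1) x) =
      ∑ x ∈ Finset.range N, min K (countUpTo f i x) +
        if countUpTo f i (f i) < K then 1 else 0 := by
  have h : ∀ x ∈ Finset.range N, min K (countUpTo f (i + 1) x) = min K (countUpTo f i x) +
      if f i = x then (if countUpTo f i (f i) < K then 1 else 0) else 0 := by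
    intro x _
    rw [countUpTo_succ f hi]
    split_ifs with h₁ h₂
    · rw [← h₁]; omega
    · rw [← h₁]; omega
    · rfl
  rw [Finset.sum_congr rfl h, Finset.sum_add_distrib, Finset.sum_ite_eq,
    if_pos (Finset.mem_range.2 hN)]

theorem countUpTo_eq_card {q : ℕ → Fin n} {mark cell : ℕ → ℕ} (hq : IsQueue v p q n mark cell)
    (hall : ∀ x, Within q n x) (h : Fin n → ℕ) (x : ℕ) :
    countUpTo (fun j => h (q j)) n x = (heightLevel v h x).card := by
  rw [countUpTo, ← Finset.card_filter]
  refine Finset.card_nbij q (fun j hj => ?_) (fun a ha b hb hab => ?_) fun u hu => ?_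
  · rw [Finset.mem_coe, Finset.mem_filter, Finset.mem_Ico] at hj
    simp [heightLevel, hj.2, hq.ne_root hj.1.1 hj.1.2]
  · rw [Finset.mem_coe, Finset.mem_filter, Finset.mem_Ico] at ha hb
    exact hq.inj ha.1.2 hb.1.2 hab
  · have hu' : u ≠ v ∧ h u = x := by simpa [heightLevel] using hu
    obtain ⟨j, hj, rfl⟩ := hall u
    refine ⟨j, ?_, rfl⟩
    have : j ≠ 0 := by
      rintro rfl
      exact hu'.1 hq.zero
    simp only [Finset.coe_filter, Finset.mem_Ico, Set.mem_ofPred_eq]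
    exact ⟨⟨by omega, hj⟩, hu'.2⟩

theorem wp_count {s : State} (h0 : s.reg 0 = n) {q : ℕ → Fin n} (hq : Searched v p s q)
    (hb : ∀ u : Fin n, s.arr 4 u < n) :
    WP count (fun t s' => s'.reg 3 = ∑ x ∈ Finset.range n,
      min (s.reg 2 - 1) (heightLevel v (fun u : Fin n => s.arr 4 u) x).card ∧
      t ≤ 12 * n + 10) s := by
  have hpos := hq.queue.pos
  simp only [count, WP.seq_iff, WP.const_iff, WP.copy_iff, WP.dec_iff]
  refine wp_fill.mono ?_
  rintro t s₁ ⟨hr, ha, hi, ht⟩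
  simp [State.setReg, h0] at hr ha hi ht
  set f : ℕ → ℕ := fun j => s.arr 4 (q j) with hf
  set K := s.reg 2 - 1 with hK
  -- Array `5` holds the counts truncated at `K`, which suffice to decide whether a count is below
  -- `K`. Position `0`, the root, is skipped.
  refine WP.loop (fun t s' => s'.reg 0 = n ∧ s'.reg 12 = K ∧ s'.arr 3 = s.arr 3 ∧
    s'.arr 4 = s.arr 4 ∧ 1 ≤ s'.reg 4 ∧ s'.reg 4 ≤ n ∧
    (∀ x < n, s'.arr 5 x = min K (countUpTo f (s'.reg 4) x)) ∧
    s'.reg 3 = ∑ x ∈ Finset.range n, min K (countUpTo f (s'.reg 4) x) ∧ t ≤ 9 * s'.reg 4)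
    (fun s' => n - s'.reg 4) ?_ ?_ ?_
  · rintro t s' ⟨h0, h12, ha3, ha4, h4, h4', ha5, h3, ht⟩ htest
    have hlt : s'.reg 4 < n := by simpa [Test.Holds, h0] using htest
    have hc : s'.arr 3 (s'.reg 4) = q (s'.reg 4) := by rw [ha3, hq.queue.cells _ hlt]
    have hh : s'.arr 4 (q (s'.reg 4)) = f (s'.reg 4) := by rw [ha4]
    have hfn : f (s'.reg 4) < n := hb _
    have hcnt := ha5 _ hfn
    have hsum := sum_min_countUpTo_succ f (K := K) h4 hfn
    simp only [WP, Test.Holds]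
    refine ⟨fun h => ?_, fun h => ?_⟩
    · simp [State.setReg, hc, hh, h12] at h
      have hK' : countUpTo f (s'.reg 4) (f (s'.reg 4)) < K := by omega
      rw [if_pos hK'] at hsum
      simp only [State.setReg, State.setArr]
      simp [hc, hh]
      refine ⟨⟨h0, h12, ha3, ha4, hlt, fun x hx => ?_, by rw [hsum, h3], by omega⟩, by omega⟩
      rw [countUpTo_succ f h4, Function.update_apply]
      split_ifs with h₁ h₂ h₂
      · rw [h₁]; omega
      · exact absurd h₁.symm h₂
      · exact absurd h₂.symm h₁
      · exact ha5 x hx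
    · simp [State.setReg, hc, hh, h12] at h
      have hK' : ¬ countUpTo f (s'.reg 4) (f (s'.reg 4)) < K := by omega
      rw [if_neg hK'] at hsum
      simp only [State.setReg]
      simp
      refine ⟨⟨h0, h12, ha3, ha4, hlt, fun x hx => ?_, by rw [hsum, h3, add_zero], by omega⟩,
        by omega⟩
      rw [countUpTo_succ f h4, ha5 x hx]
      split_ifs with h₁
      · rw [← h₁]; omega
      · rfl
  · simp [State.setReg, hr, ha, h0, hK, countUpTo]
    exact ⟨by omega, hi⟩
  · rintro t' s' ⟨h0, h12, ha3, ha4, h4, h4', ha5, h3, ht'⟩ htest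
    have heq : s'.reg 4 = n := by
      simp only [Test.Holds, h0] at htest
      omega
    refine ⟨?_, by omega⟩
    rw [h3, heq]
    refine Finset.sum_congr rfl fun x _ => ?_
    rw [← countUpTo_eq_card hq.queue hq.within]

end RAM

open SteinerEcc RAM in
/-- The two-step algorithm "determine `T(v,G)`; return `ecc_k(v,T(v,G))`" computes `ecc_k(v,G)`
and has an implementation (`determine` for the first step, `tree` for the second) that runs in
`O(k(n+m))` time. The result is returned in register `3`. -/
theorem theorem2p3 :
    ∃ (determine tree : Prog) (C : ℕ),
      ∀ (n : ℕ) (G : SimpleGraph (Fin n)) (v : Fin n) (k : ℕ),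
        G.Connected → IsBlockGraph G → 3 ≤ k → k ≤ n →
        ∀ s : State, Holds s v G k →
          ∃ (t₁ t₂ : ℕ) (s₁ s₂ : State),
            Exec determine s t₁ s₁ ∧ Holds s₁ v (nearTree v G) k ∧
            Exec tree s₁ t₂ s₂ ∧ IsEcc (nearTree v G) k v (s₂.reg 3) ∧
            IsEcc G k v (s₂.reg 3) ∧
            t₁ + t₂ ≤ C * (k * (n + G.edgeSet.ncard)) := by
  -- With `m` edges the two stages take at most `54 m + 52 n + 40` steps, and `n ≥ 3`.
  refine ⟨search ;; prune, search ;; heights ;; count, 100, fun n G v k hG hB hk hkn s hs => ?_⟩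
  obtain ⟨p, hp, hT⟩ := exists_isParentMap hG hB v
  have hTG : nearTree v G ≤ G := SimpleGraph.deleteEdges_le _
  have hpT := hp.of_adj_iff hT
  have hdet : WP (search ;; prune) (fun t s' => Holds s' v (nearTree v G) k ∧
      t ≤ 38 * G.edgeSet.ncard + 17 * n + 14) s := by
    refine WP.seq (wp_search hp hs) ?_
    rintro t s' ⟨hin, ⟨q, hq⟩, ht⟩
    have hs' : Holds s' v G k := by
      refine ⟨hin.reg0.trans hs.order, hin.reg1.trans hs.vertex, hin.reg2.trans hs.param, ?_, ?_,
        ?_⟩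
      · rw [hin.arr0, hs.start]
      · rw [hin.arr0]
        exact hs.mono
      · rw [hin.arr0, hin.arr1]
        exact hs.lists
    refine (wp_prune hTG hT hs' fun w => hq.queue.marked w (hq.within w)).mono ?_
    rintro t' s'' ⟨h, ht'⟩
    rw [hs.sum_length] at ht
    rw [hs'.sum_length] at ht'
    exact ⟨h, by omega⟩
  obtain ⟨t₁, s₁, hex₁, hs₁, ht₁⟩ := hdet.exists_exec
  have htree : WP (search ;; heights ;; count) (fun t s' => IsEcc (nearTree v G) k v (s'.reg 3) ∧
      IsEcc G k v (s'.reg 3) ∧ t ≤ 16 * (nearTree v G).edgeSet.ncard + 35 * n + 26) s₁ := by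
    -- Only `Holds` is carried over from the first stage, so the tree is searched afresh; `p` is a
    -- parent map of it as well.
    refine WP.seq (wp_search hpT hs₁) ?_
    rintro t s' ⟨hin, ⟨q, hq⟩, ht⟩
    refine WP.seq (wp_heights (hin.reg0.trans hs₁.order) hq) ?_
    rintro t' s'' ⟨h0, h2, hq', hh, hb, ht'⟩
    refine (wp_count h0 hq' hb).mono ?_
    rintro t'' s''' ⟨h3, ht''⟩
    rw [h2, hin.reg2, hs₁.param] at h3
    rw [hs₁.sum_length] at ht
    rw [h3]
    -- The same heights, and so the same sum, serve both graphs.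
    exact ⟨hpT.isEcc hh hb (by omega) (by simpa using hkn),
      hp.isEcc hh hb (by omega) (by simpa using hkn), by omega⟩
  obtain ⟨t₂, s₂, hex₂, hT₂, hG₂, ht₂⟩ := htree.exists_exec
  refine ⟨t₁, t₂, s₁, s₂, hex₁, hs₁, hex₂, hT₂, hG₂, ?_⟩
  have hle : (nearTree v G).edgeSet.ncard ≤ G.edgeSet.ncard :=
    Set.ncard_le_ncard (SimpleGraph.edgeSet_mono hTG)
  have : n + G.edgeSet.ncard ≤ k * (n + G.edgeSet.ncard) := Nat.le_mul_of_pos_left _ (by omega)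
  omega
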